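/- **Setting.** Let $p\in(1,\infty]$, let $U=\mathbb R^m$ if $p<\infty$, and let $U\subset\mathbb R^m$ be non-empty, closed and convex if $p=\infty$; fix $u_\star\in U$, with $u_\star=0$ if $p<\infty$. Norms on $\mathbb R^n,\mathbb R^m$ are arbitrary and matrices carry the operator norm. Let $\mathcal U=L^p((0,\infty),U)$ with the weak* topology $\sigma(L^p,L^{p'})$, and let $\mathcal X=W^{1,1}_{\rm loc}([0,\infty),\mathbb R^n)$ (locally absolutely continuous functions) with the topology of uniform convergence on compact subsets of $[0,\infty)$. Let $a:[0,\infty)\times\mathbb R^n\to\mathbb R^n$, $b:[0,\infty)\times\mathbb R^n\to\mathbb R^{n\times m}$, and let $\ell:(0,\infty)\times\mathbb R^n\times\mathbb R^m\to\overline{\mathbb R}$ be measurable with respect to the product of the Lebesgue $\sigma$-algebra on $(0,\infty)$ and the Borel $\sigma$-algebras on $\mathbb R^n$ and $\mathbb R^m$. For $u\in\mathcal U$ and $x_0\in\mathbb R^n$, let $x^{u,x_0}$ be the maximal locally absolutely continuous solution, with domain $[0,\tau)$, $0<\tau\le\infty$, of $$x'(t)=a(t,x(t))+b(t,x(t))u(t)\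 \text{ for a.e. } t,\qquad x(0)=x_0. \tag{1}$$ For $0\le T<\infty$ let $\mathcal A_T$ be the set of $(u,x)\in\mathcal U\times\mathcal X$ such that $u=u_\star$ a.e. on $(T,\infty)$, $x^{u,x_0}$ is defined on $[0,T]$, $x=x^{u,x_0}$ on $[0,T]$, and $x(t)=x(T)e^{-(t-T)}$ for $t>T$. Put $$\mathcal F_T(u,x)=\int_0^T\ell(t,x(t),u(t))\,dt+\chi_{\mathcal A_T}(u,x),$$ where $\chi_{\mathcal A_T}$ is $0$ on $\mathcal A_T$ and $+\infty$ elsewhere. **Proposition (sufficient conditions for equi-coercivity).** Suppose that there is $q\in(1,p)$ such that, with $r=\frac{pq}{p-q}$ if $p<\infty$ and $r=q$ if $p=\infty$, there are $M\in L^q_{\rm loc}([0,\infty))$, $N\in L^r_{\rm loc}([0,\infty))$ and, for every compact $H\subset\mathbb R^n$, functions $A_H\in L^q_{\rm loc}([0,\infty))$, $B_H\in L^r_{\rm loc}([0,\infty))$ with, for a.e. $t\ge 0$ and all $x_1,x_2\in H$, $$|a(t,0)|\le M(t),\quad |b(t,0)|\le N(t),\quad |a(t,x_1)-a(t,x_2)|\le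 A_H(t)|x_1-x_2|,\quad |b(t,x_1)-b(t,x_2)|\le B_H(t)|x_1-x_2|.$$ Suppose moreover: (a) equation (1) is dissipative with respect to $\ell$ with a coercive storage function: there is $S:\mathbb R^n\to[0,\infty)$ all of whose sublevel sets $\{S\le c\}$, $c\in\mathbb R$, are bounded, such that $$S(x^{u,y}(t))-S(y)\le\int_0^t\ell(s,x^{u,y}(s),u(s))\,ds\qquad\text{for all }u\in\mathcal U,\ y\in\mathbb R^n,\ t\in{\rm dom}(x^{u,y});$$ (b1) if $p<\infty$, there are $\alpha>0$ and $\gamma\in L^1(0,\infty)$ with $\ell(t,x,u)\ge\alpha|u|^p-\gamma(t)$ for a.e. $t>0$ and all $x\in\mathbb R^n$, $u\in\mathbb R^m$; (b2) if $p=\infty$, $U$ is compact and there is $\gamma\in L^1(0,\infty)$ with $\ell(t,x,u)\ge-\gamma(t)$ for a.e. $t>0$ and all $x\in\mathbb R^n$, $u\in\mathbb R^m$. Then for every $x_0\in\mathbb R^n$ and every sequence $0\le T_k<\infty$ with $T_k\to\infty$: 1. for every $C>0$ and every sequence $(u_k,x_k)\in\mathcal U\times\mathcal X$ with $\mathcal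 F_{T_k}(u_k,x_k)\le C$ for all $k$, the sequence $(x_k)$ is bounded in $L^\infty((0,\infty),\mathbb R^n)$; 2. the sequence $(\mathcal F_{T_k})$ is sequentially equi-coercive: for every $C>0$, every sequence $(u_k,x_k)\in\mathcal U\times\mathcal X$ with $\mathcal F_{T_k}(u_k,x_k)\le C$ for all $k$ has a subsequence converging in $\mathcal U\times\mathcal X$ (weak* in the controls, locally uniformly in the states). -/

import Mathlib

open MeasureTheory Set Filter Topology
open scoped ENNReal NNReal

noncomputable section

/-! The spaces `ℝⁿ` (states) and `ℝᵐ` (control values), each with an arbitrary norm, are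
represented by finite-dimensional real normed spaces `E` and `F`; matrices in `ℝ^{n × m}` with
the operator norm are the continuous linear maps `F →L[ℝ] E`. -/

namespace OptControl

section Spaces

variable {F : Type*} [NormedAddCommGroup F] [NormedSpace ℝ F]
variable {E : Type*} [NormedAddCommGroup E]

/-- Lebesgue measure on the half line `(0,∞)`. -/
def halfLine : Measure ℝ := volume.restrict (Ioi 0)

/-- The control space `L^p((0,∞), U)`: classes of `L^p` functions with values a.e. in `U`. -/
def ControlSpace (p : ℝ≥0∞) (U : Set F) : Type _ :=
  {u : Lp F p halfLine // ∀ᵐ t ∂halfLine, u t ∈ U}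

/-- A representative of a control. -/
def ControlSpace.fn {p : ℝ≥0∞} {U : Set F} (u : ControlSpace p U) : ℝ → F := u.1

/-- The weak-star topology `σ(L^p, L^{p'})`: the coarsest topology that makes the pairings
`u ↦ ∫₀^∞ ⟨φ(t), u(t)⟩ dt` continuous, for `φ ∈ L^{p'}((0,∞), F*)`. -/
instance instTopologicalSpaceControlSpace (p : ℝ≥0∞) (U : Set F) :
    TopologicalSpace (ControlSpace p U) :=
  ⨅ φ : Lp (F →L[ℝ] ℝ) p.conjExponent halfLine,
    TopologicalSpace.induced (fun u : ControlSpace p U => ∫ t, φ t (u.fn t) ∂halfLine)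
      inferInstance

/-- The state space `W^{1,1}_loc([0,∞), E)`: the functions on `[0,∞)` that are absolutely
continuous on every compact interval `[0,R]`. -/
def StateSpace (E : Type*) [NormedAddCommGroup E] : Type _ :=
  {x : C(ℝ≥0, E) // ∀ R : ℝ≥0,
    AbsolutelyContinuousOnInterval (fun t : ℝ => x t.toNNReal) 0 R}

/-- The value of a state at time `t ≥ 0`. -/
def StateSpace.fn (x : StateSpace E) : ℝ → E := fun t => x.1 t.toNNReal

/-- The topology of uniform convergence on compact subsets of `[0,∞)`
(the compact-open topology of `C(ℝ≥0, E)`). -/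
instance instTopologicalSpaceStateSpace : TopologicalSpace (StateSpace E) :=
  inferInstanceAs (TopologicalSpace {x : C(ℝ≥0, E) // ∀ R : ℝ≥0,
    AbsolutelyContinuousOnInterval (fun t : ℝ => x t.toNNReal) 0 R})

end Spaces

section General

/-- The indicator function of a set in the sense of convex analysis: `0` on `A`, `+∞` off `A`. -/
def chi {Z : Type*} (A : Set Z) (z : Z) : EReal :=
  open Classical in if z ∈ A then 0 else ⊤

/-- Integral of an extended-real function: the integral of the positive part minus the integral
of the negative part, meaningful as soon as one of the two is finite. -/
def eIntegral (μ : Measure ℝ) (f : ℝ → EReal) : EReal :=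
  ((∫⁻ t, (f t).toENNReal ∂μ : ℝ≥0∞) : EReal) - ((∫⁻ t, (-f t).toENNReal ∂μ : ℝ≥0∞) : EReal)

/-- Sequential equi-coercivity of a sequence of functionals on a topological space. -/
def SeqEquiCoercive {Z : Type*} [TopologicalSpace Z] (Φ : ℕ → Z → EReal) : Prop :=
  ∀ C : ℝ, 0 < C → ∀ z : ℕ → Z, (∀ k, Φ k (z k) ≤ (C : EReal)) →
    ∃ (z₀ : Z) (σ : ℕ → ℕ), StrictMono σ ∧ Tendsto (z ∘ σ) atTop (𝓝 z₀)

/-- `g ∈ L^r_loc([0,∞))`. -/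
def MemLpLoc (g : ℝ → ℝ) (r : ℝ≥0∞) : Prop :=
  ∀ R : ℝ, 0 < R → MemLp g r (volume.restrict (Ioc 0 R))

/-- A function with bounded sublevel sets. -/
def CoerciveFun {E : Type*} [NormedAddCommGroup E] (G : E → ℝ) : Prop :=
  ∀ c : ℝ, Bornology.IsBounded {x : E | G x ≤ c}

/-- The exponent `pq/(p-q)` for `q < p < ∞`, read as `q` when `p = ∞`. -/
def strongExponent (p q : ℝ≥0∞) : ℝ≥0∞ :=
  open Classical in if p = ∞ then q else p * q / (p - q)

end General

section Systems

variable {E F : Type*} [NormedAddCommGroup E] [NormedSpace ℝ E]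
  [NormedAddCommGroup F] [NormedSpace ℝ F]

/-- `g(·,0)` is bounded by an `L^r_loc` function and `g(t,·)` is Lipschitz on every compact set
with a constant that is `L^r_loc` in time. -/
def LocLipschitzWith {G : Type*} [NormedAddCommGroup G] (g : ℝ → E → G) (r : ℝ≥0∞) : Prop :=
  (∃ M : ℝ → ℝ, MemLpLoc M r ∧ ∀ᵐ t ∂halfLine, ‖g t 0‖ ≤ M t) ∧
  ∀ H : Set E, IsCompact H → ∃ A : ℝ → ℝ, MemLpLoc A r ∧
    ∀ᵐ t ∂halfLine, ∀ x₁ ∈ H, ∀ x₂ ∈ H, ‖g t x₁ - g t x₂‖ ≤ A t * ‖x₁ - x₂‖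

/-- The Carathéodory-Lipschitz conditions with exponent `r` for the drift `a` and `s` for the
control field `b`. The basic conditions are those with `r = 1` and `s = p'`. -/
def CaratheodoryLipschitz (a : ℝ → E → E) (b : ℝ → E → F →L[ℝ] E) (r s : ℝ≥0∞) : Prop :=
  LocLipschitzWith a r ∧ LocLipschitzWith b s

/-- `y` is a locally absolutely continuous solution on `[0,τ)`, `0 < τ ≤ ∞`, of
`y' = a(t,y) + b(t,y) u(t)`, `y(0) = x₀`. Values of `y` outside `[0,τ)` are irrelevant. -/
def IsSolution (a : ℝ → E → E) (b : ℝ → E → F →L[ℝ] E) (u : ℝ → F) (x₀ : E)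
    (τ : EReal) (y : ℝ → E) : Prop :=
  0 < τ ∧ y 0 = x₀ ∧
  (∀ R : ℝ, 0 ≤ R → (R : EReal) < τ → AbsolutelyContinuousOnInterval y 0 R) ∧
  ∀ᵐ t : ℝ ∂halfLine, (t : EReal) < τ → HasDerivAt y (a t (y t) + b t (y t) (u t)) t

/-- `y`, with domain `[0,τ)`, is the maximal solution `x^{u,x₀}`: a solution that no solution on a
larger interval extends. -/
def IsMaximalSolution (a : ℝ → E → E) (b : ℝ → E → F →L[ℝ] E) (u : ℝ → F) (x₀ : E)
    (τ : EReal) (y : ℝ → E) : Prop :=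
  IsSolution a b u x₀ τ y ∧
  ∀ (σ : EReal) (z : ℝ → E), IsSolution a b u x₀ σ z → τ ≤ σ →
    (∀ t : ℝ, 0 ≤ t → (t : EReal) < τ → z t = y t) → σ = τ

/-- Admissible pairs for the horizon `R`: up to time `R` the state is the maximal solution, and
after time `R` the control is constantly `uStar` and the state is `x(R) e^{-(t-R)}`. -/
def admissibleSet {p : ℝ≥0∞} {U : Set F} (a : ℝ → E → E) (b : ℝ → E → F →L[ℝ] E) (x₀ : E)
    (uStar : F) (R : ℝ) : Set (ControlSpace p U × StateSpace E) :=
  {z | (∀ᵐ t ∂halfLine, R < t → z.1.fn t = uStar) ∧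
    (∃ (τ : EReal) (y : ℝ → E), IsMaximalSolution a b z.1.fn x₀ τ y ∧ (R : EReal) < τ ∧
      ∀ t : ℝ, 0 ≤ t → t ≤ R → z.2.fn t = y t) ∧
    ∀ t : ℝ, R < t → z.2.fn t = Real.exp (-(t - R)) • z.2.fn R}

/-- The cost `∫₀^R ℓ(t, x(t), u(t)) dt`. -/
def cost (ℓ : ℝ → E → F → EReal) (R : ℝ) (u : ℝ → F) (x : ℝ → E) : EReal :=
  eIntegral (volume.restrict (Ioc 0 R)) fun t => ℓ t (x t) (u t)

/-- The joint functional: the cost plus the indicator function of the admissible set. -/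
def jointFunctional {p : ℝ≥0∞} {U : Set F} (a : ℝ → E → E) (b : ℝ → E → F →L[ℝ] E)
    (ℓ : ℝ → E → F → EReal) (x₀ : E) (uStar : F) (R : ℝ)
    (z : ControlSpace p U × StateSpace E) : EReal :=
  cost ℓ R z.1.fn z.2.fn + chi (admissibleSet a b x₀ uStar R) z

/-- `ℓ` is measurable on `(0,∞) × E × F` for the product of the Lebesgue σ-algebra and the Borel
σ-algebras. The values `ℓ t` with `t ≤ 0` are irrelevant. -/
def IsIntegrand [MeasurableSpace E] [MeasurableSpace F] (ℓ : ℝ → E → F → EReal) : Prop :=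
  Measurable fun z : NullMeasurableSpace ℝ (volume : Measure ℝ) × E × F =>
    open Classical in if (0 : ℝ) < (show ℝ from z.1) then ℓ z.1 z.2.1 z.2.2 else 0

/-- `S` is a storage function for the state equation with supply function `r`: it is nonnegative
and satisfies the dissipation inequality along every maximal solution, for all controls in
`L^p((0,∞), U)` and all initial states. -/
def IsStorageFunction (p : ℝ≥0∞) (U : Set F) (a : ℝ → E → E) (b : ℝ → E → F →L[ℝ] E)
    (r : ℝ → E → F → EReal) (S : E → ℝ) : Prop :=
  (∀ x, 0 ≤ S x) ∧
  ∀ (u : ControlSpace p U) (x₀ : E) (τ : EReal) (y : ℝ → E),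
    IsMaximalSolution a b u.fn x₀ τ y →
    ∀ t : ℝ, 0 ≤ t → (t : EReal) < τ → ((S (y t) - S x₀ : ℝ) : EReal) ≤ cost r t u.fn y

end Systems

end OptControl

end

/-! A bound on the functionals makes every pair admissible, because the lower bound on `ℓ` keeps the
cost away from `⊥`, and it bounds the integral of the positive part of the running cost by `C +
∫|γ|`. Dissipation then bounds `S` along the state up to the horizon, so coercivity of `S` puts all
states in one ball. The exponential tail does not leave that ball, which gives the first claim
(`exists_bounds_of_jointFunctional_le`). The controls are bounded in `L^p`: for `p < ∞` by the
growth of `ℓ` and because they vanish after the horizon, for `p = ∞` by compactness of `U`.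

Compactness of the states: in the ball, the derivative of a state is dominated by `m + n|u| + ρ`
with `m ∈ L^q_loc` and `n ∈ L^r_loc`. Since `1/r + 1/p = 1/q`, the dominating functions are bounded
in `L^q_loc`. As `q > 1`, Hölder bounds total increments over disjoint intervals by a positive power
of their total length. This condition (`HolderVariationOn`) yields equicontinuity for Arzelà–Ascoli,
survives pointwise limits and implies absolute continuity, so limits remain in the state space.

Weak* compactness of the controls (`ControlSpace.exists_subseq_tendsto`) comes from the same
argument applied to their primitives. A subsequence of primitives converges locally uniformly to
some `V`, and `V'` is the limit control. Difference quotients of primitives are averages of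
controls: closed convex constraints therefore pass to `V'`, and Jensen with Fatou passes on the
`L^p` bound. Convergence of primitives is convergence of integrals over intervals, which extends to
sets of finite measure and then, by density of simple functions, to all of `L^{p'}`. -/

namespace OptControl

open AbsolutelyContinuousOnInterval

/-! ### Increments of vector-valued absolutely continuous functions -/

section AbsolutelyContinuous

variable {E G : Type*} [NormedAddCommGroup E] [NormedSpace ℝ E]
  [NormedAddCommGroup G] [NormedSpace ℝ G]

theorem _root_.AbsolutelyContinuousOnInterval.clm_comp {f : ℝ → E} {a b : ℝ}
    (hf : AbsolutelyContinuousOnInterval f a b) (φ : E →L[ℝ] G) :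
    AbsolutelyContinuousOnInterval (fun t => φ (f t)) a b := by
  have h0 := Tendsto.const_mul ‖φ‖ hf
  rw [mul_zero] at h0
  refine squeeze_zero (fun I => Finset.sum_nonneg fun i _ => dist_nonneg) (fun I => ?_) h0
  simp only [Finset.mul_sum]
  refine Finset.sum_le_sum fun i _ => ?_
  rw [dist_eq_norm, dist_eq_norm, ← map_sub]
  exact φ.le_opNorm _

/-- The increment of an absolutely continuous function is bounded by the integral of any
majorant of the norm of its derivative. -/
theorem _root_.AbsolutelyContinuousOnInterval.enorm_sub_le_lintegral {f : ℝ → E} {s t : ℝ}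
    (hst : s ≤ t) (hf : AbsolutelyContinuousOnInterval f s t) {g : ℝ → ℝ≥0∞}
    (hg : ∀ᵐ r ∂volume.restrict (Ioc s t), ∃ v, HasDerivAt f v r ∧ ‖v‖ₑ ≤ g r) :
    ‖f t - f s‖ₑ ≤ ∫⁻ r in Ioc s t, g r := by
  -- A norming functional of norm at most one reduces the claim to the fundamental theorem of
  -- calculus for a real-valued function.
  obtain ⟨φ, hφ1, hφ⟩ := exists_dual_vector'' ℝ (f t - f s)
  have hac := hf.clm_comp φ
  have hftc := hac.integral_deriv_eq_sub
  rw [intervalIntegral.integral_of_le hst, ← map_sub] at hftc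
  have : ‖f t - f s‖ₑ = ‖φ (f t - f s)‖ₑ := by
    rw [hφ]; simp
  rw [this, ← hftc]
  refine (enorm_integral_le_lintegral_enorm _).trans (lintegral_mono_ae ?_)
  filter_upwards [hg] with r hr
  obtain ⟨v, hv, hvg⟩ := hr
  have hd : HasDerivAt (fun t => φ (f t)) (φ v) r := φ.hasFDerivAt.comp_hasDerivAt r hv
  rw [hd.deriv]
  refine le_trans ?_ hvg
  rw [enorm_le_iff_norm_le]
  simpa using φ.le_of_opNorm_le hφ1 v

end AbsolutelyContinuous

/-! ### A quantitative form of absolute continuity -/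

section HolderVariation

variable {E : Type*} [NormedAddCommGroup E]

/-- The total increment over disjoint subintervals of `[0,L]` is at most `D` times the `θ`-th power
of the total length. -/
def HolderVariationOn (f : ℝ → E) (L : ℝ) (D : ℝ≥0∞) (θ : ℝ) : Prop :=
  ∀ I ∈ disjWithin 0 L, ∑ i ∈ Finset.range I.1, edist (f (I.2 i).1) (f (I.2 i).2) ≤
    D * (∑ i ∈ Finset.range I.1, edist (I.2 i).1 (I.2 i).2) ^ θ

/-- Here the sum over families of intervals is essential: the Hölder estimate on single intervals
does not imply absolute continuity. -/
theorem HolderVariationOn.absolutelyContinuousOnInterval {f : ℝ → E} {L θ : ℝ} {D : ℝ≥0∞}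
    (h : HolderVariationOn f L D θ) (hD : D ≠ ∞) (hθ : 0 < θ) :
    AbsolutelyContinuousOnInterval f 0 L := by
  have h1 : Tendsto (fun I : ℕ × (ℕ → ℝ × ℝ) =>
      ENNReal.ofReal (∑ i ∈ Finset.range I.1, dist (I.2 i).1 (I.2 i).2))
      (totalLengthFilter ⊓ 𝓟 (disjWithin 0 L)) (𝓝 0) := by
    have : Tendsto (fun I : ℕ × (ℕ → ℝ × ℝ) => ∑ i ∈ Finset.range I.1, dist (I.2 i).1 (I.2 i).2)
      totalLengthFilter (𝓝 0) := tendsto_comap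
    simpa using ENNReal.tendsto_ofReal (this.mono_left inf_le_left)
  have h2 : Tendsto (fun I : ℕ × (ℕ → ℝ × ℝ) =>
      (D * (ENNReal.ofReal (∑ i ∈ Finset.range I.1, dist (I.2 i).1 (I.2 i).2)) ^ θ).toReal)
      (totalLengthFilter ⊓ 𝓟 (disjWithin 0 L)) (𝓝 0) := by
    have := ENNReal.Tendsto.const_mul (h1.ennrpow_const θ) (a := D) (Or.inr hD)
    rw [ENNReal.zero_rpow_of_pos hθ, mul_zero] at this
    exact (ENNReal.tendsto_toReal ENNReal.zero_ne_top).comp this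
  refine squeeze_zero' (Eventually.of_forall fun I => Finset.sum_nonneg fun i _ => dist_nonneg)
    ?_ h2
  refine eventually_inf_principal.2 (Eventually.of_forall fun I hI => ?_)
  have hle := h I hI
  simp only [edist_dist] at hle
  rw [← ENNReal.ofReal_sum_of_nonneg fun _ _ => dist_nonneg,
    ← ENNReal.ofReal_sum_of_nonneg fun _ _ => dist_nonneg] at hle
  refine (ENNReal.ofReal_le_iff_le_toReal ?_).1 hle
  exact ENNReal.mul_ne_top hD (ENNReal.rpow_ne_top_of_nonneg hθ.le ENNReal.ofReal_ne_top)

theorem HolderVariationOn.edist_le {f : ℝ → E} {L θ : ℝ} {D : ℝ≥0∞}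
    (h : HolderVariationOn f L D θ) {s t : ℝ} (hs : s ∈ Icc 0 L) (ht : t ∈ Icc 0 L) :
    edist (f s) (f t) ≤ D * edist s t ^ θ := by
  have hL : 0 ≤ L := hs.1.trans hs.2
  have := h (1, fun _ => (s, t)) ⟨fun i _ => by rw [uIcc_of_le hL]; exact ⟨hs, ht⟩, by
    simp⟩
  simpa using this

theorem HolderVariationOn.of_tendsto {ι : Type*} {l : Filter ι} [l.NeBot] {f : ι → ℝ → E}
    {f₀ : ℝ → E} {L θ : ℝ} {D : ℝ≥0∞} (h : ∀ i, HolderVariationOn (f i) L D θ)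
    (hf : ∀ t, 0 ≤ t → Tendsto (fun i => f i t) l (𝓝 (f₀ t))) (hL : 0 ≤ L) :
    HolderVariationOn f₀ L D θ := by
  intro I hI
  refine le_of_tendsto' (x := l) (tendsto_finsetSum _ fun i hi => ?_) fun k => h k I hI
  have := hI.1 i hi
  rw [uIcc_of_le hL] at this
  exact (hf _ this.1.1).edist (hf _ this.2.1)

theorem lintegral_enorm_le_mul_rpow {α : Type*} [MeasurableSpace α] {μ : Measure α} {q : ℝ≥0∞}
    (hq : 1 ≤ q) {g : α → E} (hg : AEStronglyMeasurable g μ) {D : ℝ≥0∞} (hD : eLpNorm g q μ ≤ D)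
    (A : Set α) : ∫⁻ r in A, ‖g r‖ₑ ∂μ ≤ D * μ A ^ (1 - 1 / q.toReal) := by
  rw [← eLpNorm_one_eq_lintegral_enorm]
  refine (eLpNorm_le_eLpNorm_mul_rpow_measure_univ hq hg.restrict).trans ?_
  simp only [ENNReal.toReal_one, div_one, Measure.restrict_apply_univ]
  gcongr
  exact (eLpNorm_restrict_le _ _ _ _).trans hD

/-- For `q = ∞` the conventions `toReal ∞ = 0` and `1 / 0 = 0` give the exponent `1`, which is the
correct Hölder exponent in that case. -/
theorem one_sub_one_div_toReal_pos {q : ℝ≥0∞} (hq : 1 < q) : 0 < 1 - 1 / q.toReal := by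
  by_cases h : q = ∞
  · simp [h]
  · have h1 : 1 < q.toReal := by
      rw [← ENNReal.toReal_one]; exact (ENNReal.toReal_lt_toReal ENNReal.one_ne_top h).2 hq
    rw [sub_pos, div_lt_one (by linarith)]
    exact h1

/-- Disjointness merges the integrals over the subintervals into one integral over their union, to
which Hölder is applied once. -/
theorem holderVariationOn_of_lintegral {q : ℝ≥0∞} (hq : 1 ≤ q) {g : ℝ → ℝ} {L : ℝ} (hL : 0 ≤ L)
    (hg : AEStronglyMeasurable g (volume.restrict (Ioc 0 L))) {D : ℝ≥0∞}
    (hD : eLpNorm g q (volume.restrict (Ioc 0 L)) ≤ D) {f : ℝ → E}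
    (hf : ∀ s t, 0 ≤ s → s ≤ t → ‖f t - f s‖ₑ ≤ ∫⁻ r in Ioc s t, ‖g r‖ₑ)
    (hθ : 0 ≤ 1 - 1 / q.toReal) :
    HolderVariationOn f L D (1 - 1 / q.toReal) := by
  rintro ⟨n, I⟩ hI
  have hI1 := hI.1
  have hsub := biUnion_uIoc_subset_of_mem_disjWithin hI
  rw [uIoc_of_le hL] at hsub
  simp only [uIcc_of_le hL] at hI1 ⊢
  have key : ∀ i ∈ Finset.range n, edist (f (I i).1) (f (I i).2) ≤
      ∫⁻ r in uIoc (I i).1 (I i).2, ‖g r‖ₑ := by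
    intro i hi
    obtain ⟨h1, h2⟩ := hI1 i hi
    rcases le_total (I i).1 (I i).2 with h | h
    · rw [uIoc_of_le h, edist_comm, edist_eq_enorm_sub]
      exact hf _ _ h1.1 h
    · rw [uIoc_of_ge h, edist_eq_enorm_sub]
      exact hf _ _ h2.1 h
  refine (Finset.sum_le_sum key).trans ?_
  rw [← lintegral_biUnion_finset hI.2 fun i _ => measurableSet_uIoc]
  have h2 : volume.restrict (⋃ i ∈ Finset.range n, uIoc (I i).1 (I i).2) =
    (volume.restrict (Ioc 0 L)).restrict (⋃ i ∈ Finset.range n, uIoc (I i).1 (I i).2) := by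
    rw [Measure.restrict_restrict_of_subset hsub]
  rw [h2]
  refine (lintegral_enorm_le_mul_rpow hq hg hD _).trans ?_
  gcongr
  refine (Measure.restrict_apply_le _ _).trans ((measure_biUnion_finset_le _ _).trans ?_)
  refine Finset.sum_le_sum fun i _ => ?_
  rw [edist_dist, Real.dist_eq, uIoc, Real.volume_Ioc, max_sub_min_eq_abs']

end HolderVariation

/-! ### Arzelà–Ascoli in the state space -/

section Compactness

variable {E : Type*} [NormedAddCommGroup E]

theorem continuous_of_holderVariationOn {f : ℝ≥0 → E} {D : ℝ≥0 → ℝ≥0} {θ : ℝ} (hθ : 0 < θ)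
    (hf : ∀ L : ℝ≥0, HolderVariationOn (fun t => f t.toNNReal) L (D L) θ) : Continuous f := by
  have h : ContinuousOn (fun t : ℝ => f t.toNNReal) (Ici 0) := by
    intro t ht
    -- The interval reaches beyond `t`, so that it is a neighbourhood of `t` within `[0,∞)`.
    have h1 := ((hf (t.toNNReal + 1)).absolutelyContinuousOnInterval
      ENNReal.coe_ne_top hθ).continuousOn
    have ht' : (0 : ℝ) ≤ t := ht
    have h2 : ((t.toNNReal + 1 : ℝ≥0) : ℝ) = t + 1 := by simp [ht']
    rw [h2, uIcc_of_le (by linarith)] at h1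
    refine (h1 t ⟨ht', by linarith⟩).mono_of_mem_nhdsWithin ?_
    rw [← Ici_inter_Iic]
    exact inter_mem self_mem_nhdsWithin (mem_nhdsWithin_of_mem_nhds (Iic_mem_nhds (by linarith)))
  have hf' : f = (fun t : ℝ => f t.toNNReal) ∘ NNReal.toReal := by
    ext t
    simp
  rw [hf']
  exact h.comp_continuous NNReal.continuous_coe (fun x => x.2)

/-- The state with the values of `f` on `[0,∞)`. -/
def StateSpace.ofHolder (f : ℝ → E) (D : ℝ≥0 → ℝ≥0) (θ : ℝ) (hθ : 0 < θ)
    (hf : ∀ L : ℝ≥0, HolderVariationOn f L (D L) θ) : StateSpace E :=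
  have hf' : ∀ L : ℝ≥0, HolderVariationOn (fun t : ℝ => f (t.toNNReal : ℝ≥0)) L (D L) θ := by
    intro L I hI
    have h1 := hf L I hI
    have h2 := hI.1
    rw [uIcc_of_le (NNReal.coe_nonneg L)] at h2
    refine le_trans (le_of_eq (Finset.sum_congr rfl fun i hi => ?_)) h1
    simp only [Real.coe_toNNReal _ (h2 i hi).1.1, Real.coe_toNNReal _ (h2 i hi).2.1]
  ⟨⟨fun t => f t, continuous_of_holderVariationOn hθ hf'⟩,
    fun L => (hf' L).absolutelyContinuousOnInterval ENNReal.coe_ne_top hθ⟩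

theorem StateSpace.ofHolder_fn {f : ℝ → E} {D : ℝ≥0 → ℝ≥0} {θ : ℝ} (hθ : 0 < θ)
    (hf : ∀ L : ℝ≥0, HolderVariationOn f L (D L) θ) {t : ℝ} (ht : 0 ≤ t) :
    (StateSpace.ofHolder f D θ hθ hf).fn t = f t := by
  simp [StateSpace.ofHolder, StateSpace.fn, ht]

theorem StateSpace.tendsto_fn {ι : Type*} {l : Filter ι} {x : ι → StateSpace E} {x₀ : StateSpace E}
    (h : Tendsto x l (𝓝 x₀)) (t : ℝ) : Tendsto (fun i => (x i).fn t) l (𝓝 (x₀.fn t)) :=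
  ((continuous_eval_const (F := C(ℝ≥0, E)) t.toNNReal).tendsto _).comp (tendsto_subtype_rng.1 h)

variable [NormedSpace ℝ E] [FiniteDimensional ℝ E]

/-- One-interval families give a common modulus of continuity and pointwise bounds. Each defining
inequality involves finitely many values of `f`, hence is closed under pointwise limits; continuity
of the limit need not be imposed, since the inequalities imply it. -/
theorem isCompact_holderVariationOn (R : ℝ) (D : ℝ≥0 → ℝ≥0) {θ : ℝ} (hθ : 0 < θ) :
    IsCompact {f : C(ℝ≥0, E) | ‖f 0‖ ≤ R ∧
      ∀ L : ℝ≥0, HolderVariationOn (fun t => f t.toNNReal) L (D L) θ} := by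
  have : ProperSpace E := FiniteDimensional.proper ℝ E
  have hbound : ∀ f : ℝ≥0 → E, ‖f 0‖ ≤ R →
      (∀ L : ℝ≥0, HolderVariationOn (fun t => f t.toNNReal) L (D L) θ) →
      ∀ t s : ℝ≥0, t ≤ s + 1 → ‖f t - f s‖ ≤ (D (s + 1) * edist (t : ℝ) s ^ θ : ℝ≥0∞).toReal := by
    intro f _ hf t s hts
    have h1 := (hf (s + 1)).edist_le (s := t) (t := s) ⟨t.2, by exact_mod_cast hts⟩
      ⟨s.2, by simp⟩
    simp only [Real.toNNReal_coe] at h1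
    rw [← dist_eq_norm, dist_edist]
    exact ENNReal.toReal_mono (ENNReal.mul_ne_top ENNReal.coe_ne_top
      (ENNReal.rpow_ne_top_of_nonneg hθ.le (edist_ne_top _ _))) h1
  refine ArzelaAscoli.isCompact_of_equicontinuous _ ?_ ?_
  · have himage : ContinuousMap.toFun '' {f : C(ℝ≥0, E) | ‖f 0‖ ≤ R ∧
        ∀ L : ℝ≥0, HolderVariationOn (fun t => f t.toNNReal) L (D L) θ} =
        {f : ℝ≥0 → E | ‖f 0‖ ≤ R ∧
          ∀ L : ℝ≥0, HolderVariationOn (fun t => f t.toNNReal) L (D L) θ} := by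
      ext f
      constructor
      · rintro ⟨g, hg, rfl⟩
        exact hg
      · intro hf
        exact ⟨⟨f, continuous_of_holderVariationOn hθ hf.2⟩, hf, rfl⟩
    rw [himage]
    refine (isCompact_univ_pi fun t : ℝ≥0 => isCompact_closedBall (0 : E)
      (R + (D (t + 1) * edist (0 : ℝ) t ^ θ : ℝ≥0∞).toReal)).of_isClosed_subset ?_ ?_
    · rw [Set.ofPred_and]
      refine (isClosed_le (continuous_apply 0).norm continuous_const).inter ?_
      simp only [Set.ofPred_forall, HolderVariationOn]
      refine isClosed_iInter fun L => isClosed_iInter fun I => isClosed_iInter fun hI => ?_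
      refine isClosed_le (continuous_finsetSum _ fun i _ => ?_) continuous_const
      exact (continuous_apply _).edist (continuous_apply _)
    · rintro f ⟨hf0, hf⟩ t -
      have h1 := hbound f hf0 hf 0 t zero_le
      rw [mem_closedBall_zero_iff]
      have h2 : ‖f t‖ ≤ ‖f 0‖ + ‖f 0 - f t‖ := by
        have := norm_sub_le (f 0) (f 0 - f t)
        simpa using this
      simp only [NNReal.coe_zero] at h1
      linarith
  · intro s
    refine Metric.equicontinuousAt_of_continuity_modulus
      (fun t : ℝ≥0 => (D (s + 1) * edist (t : ℝ) s ^ θ : ℝ≥0∞).toReal) ?_ _ ?_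
    · have h1 : Tendsto (fun t : ℝ≥0 => edist (t : ℝ) s) (𝓝 s) (𝓝 0) := by
        have : Continuous fun t : ℝ≥0 => edist (t : ℝ) s := by fun_prop
        simpa using this.tendsto s
      have := ENNReal.Tendsto.const_mul (h1.ennrpow_const θ) (a := (D (s + 1) : ℝ≥0∞))
        (Or.inr ENNReal.coe_ne_top)
      rw [ENNReal.zero_rpow_of_pos hθ, mul_zero] at this
      exact (ENNReal.tendsto_toReal ENNReal.zero_ne_top).comp this
    · have : ∀ᶠ t in 𝓝 s, t ≤ s + 1 := Iic_mem_nhds (by simp)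
      filter_upwards [this] with t ht f
      rw [dist_comm, dist_eq_norm]
      exact hbound _ f.2.1 f.2.2 t s ht

/-- Sequential compactness of sets of states that are bounded in `W^{1,q}_loc` for some `q > 1`. -/
theorem StateSpace.exists_subseq_tendsto {q : ℝ≥0∞} (hq : 1 < q) (x : ℕ → StateSpace E)
    (g : ℕ → ℝ → ℝ) (R : ℝ) (D : ℝ≥0 → ℝ≥0)
    (hg : ∀ (L : ℝ≥0) k, AEStronglyMeasurable (g k) (volume.restrict (Ioc 0 (L : ℝ))))
    (hD : ∀ (L : ℝ≥0) k, eLpNorm (g k) q (volume.restrict (Ioc 0 (L : ℝ))) ≤ D L)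
    (hR : ∀ k, ‖(x k).fn 0‖ ≤ R)
    (hx : ∀ k s t, 0 ≤ s → s ≤ t → ‖(x k).fn t - (x k).fn s‖ₑ ≤ ∫⁻ r in Ioc s t, ‖g k r‖ₑ) :
    ∃ (x₀ : StateSpace E) (σ : ℕ → ℕ), StrictMono σ ∧ Tendsto (x ∘ σ) atTop (𝓝 x₀) := by
  have hθ := one_sub_one_div_toReal_pos hq
  obtain ⟨f, hf, σ, hσ, hlim⟩ := (isCompact_holderVariationOn (E := E) R D hθ).tendsto_subseq
    (x := fun k => (x k).1) fun k => ⟨by simpa [StateSpace.fn] using hR k, fun L =>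
      holderVariationOn_of_lintegral hq.le L.2 (hg L k) (hD L k) (hx k) hθ.le⟩
  refine ⟨⟨f, fun L => (hf.2 L).absolutelyContinuousOnInterval ENNReal.coe_ne_top hθ⟩, σ, hσ, ?_⟩
  exact tendsto_subtype_rng.2 hlim

end Compactness

/-! ### From integrals over intervals to all test functions -/

section WeakConvergence

variable {α F : Type*} [MeasurableSpace α] {μ : Measure α} [NormedAddCommGroup F]

theorem _root_.MeasureTheory.MemLp.integrableOn_of_measure_lt_top {p : ℝ≥0∞} (hp : 1 ≤ p)
    {w : α → F} (hw : MemLp w p μ) {A : Set α} (hA : μ A < ∞) : IntegrableOn w A μ :=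
  have : IsFiniteMeasure (μ.restrict A) := isFiniteMeasure_restrict.2 hA.ne
  (hw.restrict A).integrable hp

variable [NormedSpace ℝ F]

theorem enorm_setIntegral_le_mul_rpow {p : ℝ≥0∞} (hp : 1 ≤ p) {w : α → F}
    (hw : AEStronglyMeasurable w μ) {D : ℝ≥0∞} (hD : eLpNorm w p μ ≤ D) (A : Set α) :
    ‖∫ t in A, w t ∂μ‖ₑ ≤ D * μ A ^ (1 - 1 / p.toReal) :=
  (enorm_integral_le_lintegral_enorm _).trans (lintegral_enorm_le_mul_rpow hp hw hD A)

/-- Convergence of integrals over sets that exhaust `A` up to small measure gives convergence of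
the integrals over `A`, for sequences bounded in `L^p`, `p > 1`. -/
theorem tendsto_setIntegral_of_measure_diff {p : ℝ≥0∞} (hp : 1 < p) {w : ℕ → α → F} {w₀ : α → F}
    {D : ℝ≥0} (hw : ∀ k, AEStronglyMeasurable (w k) μ) (hD : ∀ k, eLpNorm (w k) p μ ≤ D)
    (hw₀ : AEStronglyMeasurable w₀ μ) (hD₀ : eLpNorm w₀ p μ ≤ D) {A : Set α} (hA : μ A < ∞)
    {B : ℕ → Set α} (hB : ∀ n, MeasurableSet (B n)) (hBA : ∀ n, B n ⊆ A)
    (hlim : Tendsto (fun n => μ (A \ B n)) atTop (𝓝 0))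
    (hT : ∀ n, Tendsto (fun k => ∫ t in B n, w k t ∂μ) atTop (𝓝 (∫ t in B n, w₀ t ∂μ))) :
    Tendsto (fun k => ∫ t in A, w k t ∂μ) atTop (𝓝 (∫ t in A, w₀ t ∂μ)) := by
  have hθ := one_sub_one_div_toReal_pos hp
  have hc : Tendsto (fun n => D * μ (A \ B n) ^ (1 - 1 / p.toReal)) atTop (𝓝 0) := by
    have := ENNReal.Tendsto.const_mul (hlim.ennrpow_const (1 - 1 / p.toReal)) (a := (D : ℝ≥0∞))
      (Or.inr ENNReal.coe_ne_top)
    rwa [ENNReal.zero_rpow_of_pos hθ, mul_zero] at this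
  have hdiff : ∀ v : α → F, AEStronglyMeasurable v μ → eLpNorm v p μ ≤ D → ∀ n,
      edist (∫ t in A, v t ∂μ) (∫ t in B n, v t ∂μ) ≤ D * μ (A \ B n) ^ (1 - 1 / p.toReal) := by
    intro v hv hvD n
    have hint : IntegrableOn v A μ := MemLp.integrableOn_of_measure_lt_top hp.le
      ⟨hv, hvD.trans_lt ENNReal.coe_lt_top⟩ hA
    rw [edist_eq_enorm_sub, ← setIntegral_sdiff (hB n) hint (hBA n)]
    exact enorm_setIntegral_le_mul_rpow hp.le hv hvD _
  -- The error in replacing `A` by `B n` is uniform in `k`, so the limits in `n` and `k` can be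
  -- interchanged.
  have hunif : TendstoUniformly (fun n k => ∫ t in B n, w k t ∂μ)
      (fun k => ∫ t in A, w k t ∂μ) atTop := by
    rw [EMetric.tendstoUniformly_iff]
    intro ε hε
    filter_upwards [hc.eventually (gt_mem_nhds hε)] with n hn k
    exact (hdiff _ (hw k) (hD k) n).trans_lt hn
  refine hunif.tendsto_of_eventually_tendsto (Eventually.of_forall hT) ?_
  rw [tendsto_iff_edist_tendsto_0]
  refine tendsto_of_tendsto_of_tendsto_of_le_of_le tendsto_const_nhds hc (fun n => zero_le) ?_
  exact fun n => (edist_comm _ _).trans_le (hdiff w₀ hw₀ hD₀ n)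

/-- For sequences bounded in `L^p(ℝ)`, `p > 1`, convergence of the integrals over half lines
`(-∞, m]` of finite measure gives convergence of the integrals over sets of finite measure. -/
theorem tendsto_setIntegral_of_tendsto_setIntegral_Iic {μ : Measure ℝ} {p : ℝ≥0∞} (hp : 1 < p)
    {w : ℕ → ℝ → F} {w₀ : ℝ → F} {D : ℝ≥0} (hw : ∀ k, AEStronglyMeasurable (w k) μ)
    (hD : ∀ k, eLpNorm (w k) p μ ≤ D) (hw₀ : AEStronglyMeasurable w₀ μ)
    (hD₀ : eLpNorm w₀ p μ ≤ D) (hμ : ∀ m, μ (Iic m) < ∞)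
    (hT : ∀ m, Tendsto (fun k => ∫ t in Iic m, w k t ∂μ) atTop (𝓝 (∫ t in Iic m, w₀ t ∂μ)))
    {A : Set ℝ} (hAm : MeasurableSet A) (hA : μ A < ∞) :
    Tendsto (fun k => ∫ t in A, w k t ∂μ) atTop (𝓝 (∫ t in A, w₀ t ∂μ)) := by
  have hint : ∀ v : ℝ → F, AEStronglyMeasurable v μ → eLpNorm v p μ ≤ D → ∀ {A : Set ℝ},
      μ A < ∞ → IntegrableOn v A μ := fun v hv hvD A hA =>
    MemLp.integrableOn_of_measure_lt_top hp.le ⟨hv, hvD.trans_lt ENNReal.coe_lt_top⟩ hA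
  have hfin : ∀ (L : ℝ) (A : Set ℝ), μ (A ∩ Iic L) < ∞ := fun L A =>
    (measure_mono inter_subset_right).trans_lt (hμ L)
  -- Truncation at `L` keeps all measures finite, so complements can be handled by subtraction in
  -- the π-λ argument.
  have hbdd : ∀ (L : ℝ) (A : Set ℝ), MeasurableSet A →
      Tendsto (fun k => ∫ t in A ∩ Iic L, w k t ∂μ) atTop (𝓝 (∫ t in A ∩ Iic L, w₀ t ∂μ)) := by
    intro L A hAm
    induction A, hAm using MeasurableSpace.induction_on_inter
      (borel_eq_generateFrom_Iic ℝ) isPiSystem_Iic with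
    | empty => simp
    | basic t ht =>
      obtain ⟨m, rfl⟩ := ht
      simp only [Iic_inter_Iic]
      exact hT _
    | compl A hAm ih =>
      have h : ∀ v : ℝ → F, AEStronglyMeasurable v μ → eLpNorm v p μ ≤ D →
          ∫ t in Aᶜ ∩ Iic L, v t ∂μ = ∫ t in Iic L, v t ∂μ - ∫ t in A ∩ Iic L, v t ∂μ := by
        intro v hv hvD
        rw [← setIntegral_sdiff (hAm.inter measurableSet_Iic) (hint v hv hvD (hμ L))
          inter_subset_right]
        congr 2
        ext t
        simp only [mem_inter_iff, mem_compl_iff, Set.mem_sdiff]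
        tauto
      rw [h w₀ hw₀ hD₀]
      exact ((hT L).sub ih).congr fun k => (h _ (hw k) (hD k)).symm
    | iUnion f hdisj hfm ih =>
      have hsub : ∀ n : ℕ, (⋃ i ∈ Finset.range n, f i) ⊆ ⋃ i, f i := fun n =>
        iUnion₂_subset fun i _ => subset_iUnion f i
      have hm : ∀ n : ℕ, MeasurableSet (⋃ i ∈ Finset.range n, f i) := fun n =>
        Finset.measurableSet_biUnion _ fun i _ => hfm i
      refine tendsto_setIntegral_of_measure_diff hp hw hD hw₀ hD₀ (hfin L _)
        (B := fun n => (⋃ i ∈ Finset.range n, f i) ∩ Iic L)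
        (fun n => (hm n).inter measurableSet_Iic)
        (fun n => inter_subset_inter_left _ (hsub n)) ?_ ?_
      · have hanti : Antitone fun n : ℕ =>
            ((⋃ i, f i) ∩ Iic L) \ ((⋃ i ∈ Finset.range n, f i) ∩ Iic L) := by
          intro m n hmn
          refine sdiff_subset_sdiff_right (inter_subset_inter_left _ ?_)
          exact biUnion_subset_biUnion_left fun i hi => Finset.range_mono hmn hi
        have h := tendsto_measure_iInter_atTop (μ := μ)
          (fun n => (((MeasurableSet.iUnion hfm).inter measurableSet_Iic).diff
            ((hm n).inter measurableSet_Iic)).nullMeasurableSet) hanti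
          ⟨0, ((measure_mono sdiff_subset).trans_lt (hfin L _)).ne⟩
        have hempty : ⋂ n : ℕ, ((⋃ i, f i) ∩ Iic L) \ ((⋃ i ∈ Finset.range n, f i) ∩ Iic L)
            = ∅ := by
          refine eq_empty_of_forall_notMem fun t ht => ?_
          have ht0 := (mem_iInter.1 ht 0).1
          obtain ⟨i, hi⟩ := mem_iUnion.1 ht0.1
          -- The index `i + 1` is needed because `range i` omits `i`.
          exact (mem_iInter.1 ht (i + 1)).2
            ⟨mem_iUnion₂.2 ⟨i, Finset.self_mem_range_succ i, hi⟩, ht0.2⟩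
        rwa [hempty, measure_empty] at h
      · intro n
        have h : ∀ v : ℝ → F, AEStronglyMeasurable v μ → eLpNorm v p μ ≤ D →
            ∫ t in (⋃ i ∈ Finset.range n, f i) ∩ Iic L, v t ∂μ =
              ∑ i ∈ Finset.range n, ∫ t in f i ∩ Iic L, v t ∂μ := by
          intro v hv hvD
          rw [iUnion₂_inter, integral_biUnion_finset _
            (fun i _ => (hfm i).inter measurableSet_Iic) ?_ fun i _ => hint v hv hvD (hfin L _)]
          intro i _ j _ hij
          exact (hdisj hij).mono inter_subset_left inter_subset_left
        rw [h w₀ hw₀ hD₀]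
        exact (tendsto_finsetSum _ fun i _ => ih i).congr fun k => (h _ (hw k) (hD k)).symm
  refine tendsto_setIntegral_of_measure_diff hp hw hD hw₀ hD₀ hA
    (B := fun n : ℕ => A ∩ Iic (n : ℝ)) (fun n => hAm.inter measurableSet_Iic)
    (fun n => inter_subset_left) ?_ fun n => hbdd n A hAm
  have hanti : Antitone fun n : ℕ => A \ (A ∩ Iic (n : ℝ)) := fun m n hmn =>
    sdiff_subset_sdiff_right (inter_subset_inter_right _ (Iic_subset_Iic.2 (by exact_mod_cast hmn)))
  have h := tendsto_measure_iInter_atTop (μ := μ)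
    (fun n : ℕ => (hAm.diff (hAm.inter measurableSet_Iic)).nullMeasurableSet) hanti
    ⟨0, ((measure_mono sdiff_subset).trans_lt hA).ne⟩
  have hempty : ⋂ n : ℕ, A \ (A ∩ Iic (n : ℝ)) = ∅ := by
    refine eq_empty_of_forall_notMem fun t ht => ?_
    obtain ⟨n, hn⟩ := exists_nat_ge t
    have := mem_iInter.1 ht n
    exact this.2 ⟨this.1, hn⟩
  rwa [hempty, measure_empty] at h

/-- Convergence against the members of a bounded sequence of `L^p` functions is a closed condition
on the test function. -/
theorem isClosed_tendsto_apply {X Y : Type*} [NormedAddCommGroup X] [NormedSpace ℝ X]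
    [NormedAddCommGroup Y] [NormedSpace ℝ Y] (Λ : X →L[ℝ] Y →L[ℝ] ℝ) {u : ℕ → Y} {u₀ : Y} {D : ℝ}
    (hD : ∀ k, ‖u k‖ ≤ D) :
    IsClosed {φ : X | Tendsto (fun k => Λ φ (u k)) atTop (𝓝 (Λ φ u₀))} := by
  refine IsSeqClosed.isClosed fun φ φ₀ hφ hlim => ?_
  have hunif : TendstoUniformly (fun n k => Λ (φ n) (u k)) (fun k => Λ φ₀ (u k)) atTop := by
    rw [Metric.tendstoUniformly_iff]
    intro ε hε
    have h0 : Tendsto (fun n => ‖Λ (φ₀ - φ n)‖ * D) atTop (𝓝 0) := by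
      have : Continuous fun ψ => ‖Λ (φ₀ - ψ)‖ * D := by fun_prop
      have h := (this.tendsto φ₀).comp hlim
      rwa [sub_self, map_zero, norm_zero, zero_mul] at h
    filter_upwards [h0.eventually (gt_mem_nhds hε)] with n hn k
    refine lt_of_le_of_lt ?_ hn
    rw [dist_eq_norm, ← sub_apply, ← map_sub]
    exact (Λ (φ₀ - φ n)).le_of_opNorm_le_of_le le_rfl (hD k)
  refine hunif.tendsto_of_eventually_tendsto (Eventually.of_forall hφ) ?_
  have : Continuous fun ψ => Λ ψ u₀ := by fun_prop
  exact (this.tendsto φ₀).comp hlim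

/-- Indicators with constant functional reduce to `hT`. Their span is dense in `L^{p'}` because `p'
< ∞`, and boundedness of the sequence makes the set of good test functions closed. -/
theorem tendsto_integral_apply_of_tendsto_setIntegral [CompleteSpace F] {p p' : ℝ≥0∞}
    (hp : 1 ≤ p) (hp' : 1 ≤ p') (hp'top : p' ≠ ∞) (hpp : p'.HolderConjugate p)
    {u : ℕ → Lp F p μ} {u₀ : Lp F p μ} {D : ℝ} (hD : ∀ k, ‖u k‖ ≤ D)
    (hT : ∀ A, MeasurableSet A → μ A < ∞ →
      Tendsto (fun k => ∫ t in A, u k t ∂μ) atTop (𝓝 (∫ t in A, u₀ t ∂μ)))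
    (φ : Lp (F →L[ℝ] ℝ) p' μ) :
    Tendsto (fun k => ∫ t, φ t (u k t) ∂μ) atTop (𝓝 (∫ t, φ t (u₀ t) ∂μ)) := by
  have : Fact (1 ≤ p) := ⟨hp⟩
  have : Fact (1 ≤ p') := ⟨hp'⟩
  set Λ := (ContinuousLinearMap.id ℝ (F →L[ℝ] ℝ)).lpPairing μ p' p
  have hΛ : ∀ φ u, Λ φ u = ∫ t, φ t (u t) ∂μ := fun φ u =>
    ContinuousLinearMap.lpPairing_eq_integral _ φ u
  simp only [← hΛ]
  induction φ using Lp.induction hp'top with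
  | indicatorConst c hs hμs =>
    rename_i s
    have h : ∀ v : Lp F p μ, Λ (Lp.simpleFunc.indicatorConst p' hs hμs.ne c : Lp (F →L[ℝ] ℝ) p' μ) v
        = c (∫ t in s, v t ∂μ) := by
      intro v
      rw [hΛ, ← ContinuousLinearMap.integral_comp_comm c
        ((Lp.memLp v).integrableOn_of_measure_lt_top hp hμs), ← integral_indicator hs]
      refine integral_congr_ae ?_
      rw [Lp.simpleFunc.coe_indicatorConst]
      filter_upwards [indicatorConstLp_coeFn (p := p') (hs := hs) (hμs := hμs.ne) (c := c)]
        with t ht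
      rw [ht]
      by_cases hts : t ∈ s <;> simp [hts]
    simp only [h]
    exact (c.continuous.tendsto _).comp (hT s hs hμs)
  | add hf hg _ h1 h2 =>
    simp only [map_add, add_apply]
    exact h1.add h2
  | isClosed => exact isClosed_tendsto_apply Λ hD

end WeakConvergence

/-! ### Primitives and their difference quotients -/

section Primitive

variable {F : Type*} [NormedAddCommGroup F]

theorem halfLine_restrict_Ioc {s : ℝ} (hs : 0 ≤ s) (t : ℝ) :
    halfLine.restrict (Ioc s t) = volume.restrict (Ioc s t) :=
  Measure.restrict_restrict_of_subset (Ioc_subset_Ioi_self.trans (Ioi_subset_Ioi hs))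

theorem halfLine_restrict_Iic (m : ℝ) :
    halfLine.restrict (Iic m) = volume.restrict (Ioc 0 m) := by
  rw [halfLine, Measure.restrict_restrict measurableSet_Iic, Iic_inter_Ioi]

theorem halfLine_Iic_lt_top (m : ℝ) : halfLine (Iic m) < ∞ := by
  rw [← Measure.restrict_apply_univ, halfLine_restrict_Iic]
  simp

theorem _root_.MeasureTheory.MemLp.integrableOn_Ioc_of_halfLine {p : ℝ≥0∞} (hp : 1 ≤ p)
    {w : ℝ → F} (hw : MemLp w p halfLine) {s : ℝ} (hs : 0 ≤ s) (t : ℝ) :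
    IntegrableOn w (Ioc s t) := by
  have := hw.integrableOn_of_measure_lt_top hp
    (((measure_mono Ioc_subset_Iic_self).trans_lt (halfLine_Iic_lt_top t)) :
      halfLine (Ioc s t) < ∞)
  rwa [IntegrableOn, halfLine_restrict_Ioc hs] at this

/-- Fatou's lemma for `L^p` norms. -/
theorem eLpNorm_le_of_ae_tendsto {α : Type*} [MeasurableSpace α] {μ : Measure α} {p D : ℝ≥0∞}
    {f : ℕ → α → F} {f₀ : α → F} (hf : ∀ n, AEStronglyMeasurable (f n) μ)
    (hD : ∀ n, eLpNorm (f n) p μ ≤ D) (hlim : ∀ᵐ t ∂μ, Tendsto (fun n => f n t) atTop (𝓝 (f₀ t))) :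
    eLpNorm f₀ p μ ≤ D :=
  (Lp.eLpNorm_lim_le_liminf_eLpNorm hf f₀ hlim).trans
    (liminf_le_of_frequently_le' (Frequently.of_forall hD))

theorem lintegral_enorm_shift_le (w : ℝ → F) (P : ℝ) {s : ℝ}
    (hs : 0 ≤ s) :
    ∫⁻ t, ‖w (t + s)‖ₑ ^ P ∂halfLine ≤ ∫⁻ t, ‖w t‖ₑ ^ P ∂halfLine := by
  set G : ℝ → ℝ≥0∞ := (Ioi 0).indicator fun t => ‖w t‖ₑ ^ P
  have h1 : ∫⁻ t, G t = ∫⁻ t, ‖w t‖ₑ ^ P ∂halfLine := lintegral_indicator measurableSet_Ioi _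
  rw [← h1, ← lintegral_add_right_eq_self G s]
  refine (setLIntegral_mono_ae' measurableSet_Ioi ?_).trans (setLIntegral_le_lintegral (Ioi 0) _)
  refine Eventually.of_forall fun t ht => ?_
  have ht' : t + s ∈ Ioi (0 : ℝ) := by
    have : (0 : ℝ) < t := ht
    exact mem_Ioi.2 (by linarith)
  exact (indicator_of_mem ht' fun t => ‖w t‖ₑ ^ P).ge

variable [NormedSpace ℝ F]

/-- The primitive of `w` on `[0,∞)` that vanishes at `0`. -/
noncomputable def primitive (w : ℝ → F) (t : ℝ) : F := ∫ r in Ioc 0 t, w r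

theorem primitive_sub_primitive {p : ℝ≥0∞} (hp : 1 ≤ p) {w : ℝ → F} (hw : MemLp w p halfLine)
    {s t : ℝ} (hs : 0 ≤ s) (hst : s ≤ t) :
    primitive w t - primitive w s = ∫ r in Ioc s t, w r := by
  have h : Ioc 0 s ∪ Ioc s t = Ioc 0 t := Ioc_union_Ioc_eq_Ioc hs hst
  have hd : Disjoint (Ioc 0 s) (Ioc s t) := Ioc_disjoint_Ioc_of_le le_rfl
  rw [primitive, primitive, ← h, setIntegral_union hd measurableSet_Ioc
    (hw.integrableOn_Ioc_of_halfLine hp le_rfl s) (hw.integrableOn_Ioc_of_halfLine hp hs t)]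
  abel

theorem holderVariationOn_primitive {p : ℝ≥0∞} (hp : 1 < p) {w : ℝ → F}
    (hw : AEStronglyMeasurable w halfLine) {D : ℝ≥0} (hD : eLpNorm w p halfLine ≤ D) (L : ℝ≥0) :
    HolderVariationOn (primitive w) L D (1 - 1 / p.toReal) := by
  have hmem : MemLp w p halfLine := ⟨hw, hD.trans_lt ENNReal.coe_lt_top⟩
  refine holderVariationOn_of_lintegral hp.le (g := fun r => ‖w r‖) L.2 ?_ ?_ ?_
    (one_sub_one_div_toReal_pos hp).le
  · rw [← halfLine_restrict_Ioc le_rfl]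
    exact hw.norm.restrict
  · rw [eLpNorm_norm, ← halfLine_restrict_Ioc le_rfl]
    exact (eLpNorm_restrict_le _ _ _ _).trans hD
  · intro s t hs hst
    rw [primitive_sub_primitive hp.le hmem hs hst]
    simpa using enorm_integral_le_lintegral_enorm (μ := volume.restrict (Ioc s t)) w

/-- The forward difference quotient. -/
noncomputable def diffQuot (h : ℝ) (f : ℝ → F) (t : ℝ) : F := h⁻¹ • (f (t + h) - f t)

theorem diffQuot_primitive {p : ℝ≥0∞} (hp : 1 ≤ p) {w : ℝ → F} (hw : MemLp w p halfLine)
    {h t : ℝ} (hh : 0 < h) (ht : 0 ≤ t) :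
    diffQuot h (primitive w) t = ⨍ r in Ioc t (t + h), w r := by
  rw [diffQuot, primitive_sub_primitive hp hw ht (by linarith), setAverage_eq]
  simp [Measure.real, hh.le]

theorem diffQuot_primitive_mem [CompleteSpace F] {p : ℝ≥0∞} (hp : 1 ≤ p) {w : ℝ → F}
    (hw : MemLp w p halfLine) {U : Set F} (hUc : IsClosed U) (hUconv : Convex ℝ U)
    (hU : ∀ᵐ r ∂halfLine, w r ∈ U) {h t : ℝ} (hh : 0 < h) (ht : 0 ≤ t) :
    diffQuot h (primitive w) t ∈ U := by
  rw [diffQuot_primitive hp hw hh ht]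
  refine hUconv.set_average_mem hUc (by simp [hh]) (by simp) ?_
    (hw.integrableOn_Ioc_of_halfLine hp ht _)
  rw [← halfLine_restrict_Ioc ht]
  exact ae_restrict_of_ae hU

theorem tendsto_diffQuot {f : ℝ → F} {t : ℝ} (hf : DifferentiableAt ℝ f t) :
    Tendsto (fun n : ℕ => diffQuot (1 / ((n : ℝ) + 1)) f t) atTop (𝓝 (deriv f t)) := by
  refine hf.hasDerivAt.tendsto_slope_zero.comp (tendsto_nhdsWithin_iff.2
    ⟨tendsto_one_div_add_atTop_nhds_zero_nat, Eventually.of_forall fun n => ?_⟩)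
  have : (0 : ℝ) < 1 / ((n : ℝ) + 1) := by positivity
  exact this.ne'

/-- The quotient is the mean of the translates of `w` by shifts in `(0,h]`. Jensen moves the `p`-th
power inside the mean, Tonelli exchanges the integrals, and forward translation does not increase
the integral over the half line. -/
theorem eLpNorm_diffQuot_primitive_le {p : ℝ≥0∞} (hp : 1 < p) (hptop : p ≠ ∞) {w : ℝ → F}
    (hwm : StronglyMeasurable w) (hw : MemLp w p halfLine) {h : ℝ} (hh : 0 < h) :
    eLpNorm (diffQuot h (primitive w)) p halfLine ≤ eLpNorm w p halfLine := by
  have hp0 : p ≠ 0 := (zero_lt_one.trans hp).ne'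
  have hP : 0 < p.toReal := ENNReal.toReal_pos hp0 hptop
  -- The uniform probability on the shifts; for it, Jensen is the comparison of the `L^1` and `L^p`
  -- norms.
  set μ : Measure ℝ := (ENNReal.ofReal h)⁻¹ • volume.restrict (Ioc 0 h) with hμ
  have hprob : IsProbabilityMeasure μ := by
    constructor
    simp only [hμ, Measure.smul_apply, Measure.restrict_apply_univ, Real.volume_Ioc, sub_zero,
      smul_eq_mul]
    exact ENNReal.inv_mul_cancel (by simpa using hh) ENNReal.ofReal_ne_top
  have hpt : ∀ t, 0 ≤ t → ‖diffQuot h (primitive w) t‖ₑ ^ p.toReal ≤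
      ∫⁻ s, ‖w (t + s)‖ₑ ^ p.toReal ∂μ := by
    intro t ht
    have hm : AEStronglyMeasurable (fun s => w (t + s)) μ :=
      (hwm.comp_measurable (measurable_const_add t)).aestronglyMeasurable
    have h1 : ‖diffQuot h (primitive w) t‖ₑ ≤ eLpNorm (fun s => w (t + s)) p μ := by
      refine le_trans ?_ (eLpNorm_le_eLpNorm_of_exponent_le hp.le hm)
      rw [eLpNorm_one_eq_lintegral_enorm, diffQuot,
        primitive_sub_primitive hp.le hw ht (by linarith), enorm_smul, hμ,
        lintegral_smul_measure, smul_eq_mul]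
      have hinv : ‖h⁻¹‖ₑ = (ENNReal.ofReal h)⁻¹ := by
        rw [enorm_inv hh.ne', Real.enorm_of_nonneg hh.le]
      rw [hinv]
      gcongr
      refine (enorm_integral_le_lintegral_enorm _).trans (le_of_eq ?_)
      rw [← lintegral_indicator measurableSet_Ioc, ← lintegral_indicator measurableSet_Ioc,
        ← lintegral_add_left_eq_self _ t]
      refine lintegral_congr fun s => ?_
      by_cases hs : s ∈ Ioc 0 h
      · have : t + s ∈ Ioc t (t + h) := ⟨by linarith [hs.1], by linarith [hs.2]⟩
        rw [indicator_of_mem hs, indicator_of_mem this]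
      · have : t + s ∉ Ioc t (t + h) := fun h' => hs ⟨by linarith [h'.1], by linarith [h'.2]⟩
        rw [indicator_of_notMem hs, indicator_of_notMem this]
    rw [eLpNorm_eq_lintegral_rpow_enorm_toReal hp0 hptop] at h1
    refine (ENNReal.rpow_le_rpow h1 hP.le).trans (le_of_eq ?_)
    rw [← ENNReal.rpow_mul, one_div, inv_mul_cancel₀ hP.ne', ENNReal.rpow_one]
  rw [eLpNorm_eq_lintegral_rpow_enorm_toReal hp0 hptop,
    eLpNorm_eq_lintegral_rpow_enorm_toReal hp0 hptop]
  refine ENNReal.rpow_le_rpow ?_ (by positivity)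
  have hae : ∀ᵐ t ∂halfLine, (0 : ℝ) ≤ t :=
    (ae_restrict_mem measurableSet_Ioi).mono fun t ht => (mem_Ioi.1 ht).le
  calc ∫⁻ t, ‖diffQuot h (primitive w) t‖ₑ ^ p.toReal ∂halfLine
      ≤ ∫⁻ t, ∫⁻ s, ‖w (t + s)‖ₑ ^ p.toReal ∂μ ∂halfLine :=
        lintegral_mono_ae (hae.mono hpt)
    _ = ∫⁻ s, ∫⁻ t, ‖w (t + s)‖ₑ ^ p.toReal ∂halfLine ∂μ := by
        have : SFinite halfLine := by unfold halfLine; infer_instance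
        refine lintegral_lintegral_swap (Measurable.aemeasurable ?_)
        exact ((hwm.comp_measurable measurable_add).enorm).pow_const _
    _ ≤ ∫⁻ s, ∫⁻ t, ‖w t‖ₑ ^ p.toReal ∂halfLine ∂μ := by
        refine lintegral_mono_ae ?_
        have hs : ∀ᵐ s ∂μ, (0 : ℝ) ≤ s := Measure.ae_smul_measure
          ((ae_restrict_mem measurableSet_Ioc).mono fun s hs => hs.1.le) _
        exact hs.mono fun s hs => lintegral_enorm_shift_le w _ hs
    _ = ∫⁻ t, ‖w t‖ₑ ^ p.toReal ∂halfLine := by simp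

end Primitive

/-! ### Weak-star compactness of controls -/

section WeakStar

theorem ControlSpace.tendsto_of_tendsto_integral {F : Type*} [NormedAddCommGroup F]
    [NormedSpace ℝ F] {p : ℝ≥0∞} {U : Set F} {ι : Type*} {l : Filter ι} {u : ι → ControlSpace p U}
    {u₀ : ControlSpace p U}
    (h : ∀ φ : Lp (F →L[ℝ] ℝ) p.conjExponent halfLine,
      Tendsto (fun i => ∫ t, φ t ((u i).fn t) ∂halfLine) l (𝓝 (∫ t, φ t (u₀.fn t) ∂halfLine))) :
    Tendsto u l (𝓝 u₀) := by
  unfold instTopologicalSpaceControlSpace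
  rw [nhds_iInf]
  refine tendsto_iInf.2 fun φ => ?_
  rw [nhds_induced, tendsto_comap_iff]
  exact h φ

variable {F : Type*} [NormedAddCommGroup F] [NormedSpace ℝ F] [FiniteDimensional ℝ F]

theorem StateSpace.ae_differentiableAt (V : StateSpace F) :
    ∀ᵐ t ∂halfLine, DifferentiableAt ℝ V.fn t := by
  have h : ∀ n : ℕ, ∀ᵐ t : ℝ, t ∈ uIcc 0 ((n : ℝ≥0) : ℝ) → DifferentiableAt ℝ V.fn t := fun n =>
    (V.2 n).boundedVariationOn.ae_differentiableAt_of_mem_uIcc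
  refine (ae_restrict_iff' measurableSet_Ioi).2 ?_
  filter_upwards [ae_all_iff.2 h] with t ht ht0
  obtain ⟨n, hn⟩ := exists_nat_ge t
  refine ht n ?_
  rw [uIcc_of_le (NNReal.coe_nonneg _)]
  exact ⟨(mem_Ioi.1 ht0).le, by simpa using hn⟩

theorem StateSpace.setIntegral_deriv (V : StateSpace F) {m : ℝ} (hm : 0 ≤ m)
    (hint : IntegrableOn (deriv V.fn) (Ioc 0 m)) :
    ∫ t in Ioc 0 m, deriv V.fn t = V.fn m - V.fn 0 := by
  have := FiniteDimensional.complete ℝ F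
  rw [SeparatingDual.eq_iff_forall_dual_eq (R := ℝ)]
  intro c
  have hV : AbsolutelyContinuousOnInterval V.fn 0 m := by
    have h := V.2 m.toNNReal
    rwa [Real.coe_toNNReal _ hm] at h
  rw [← ContinuousLinearMap.integral_comp_comm c hint, map_sub,
    ← (hV.clm_comp c).integral_deriv_eq_sub, intervalIntegral.integral_of_le hm]
  refine integral_congr_ae ?_
  rw [← halfLine_restrict_Ioc le_rfl]
  filter_upwards [ae_restrict_of_ae V.ae_differentiableAt] with t ht
  exact (c.hasFDerivAt.comp_hasDerivAt t ht.hasDerivAt).deriv.symm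

/-- Sequential weak-star compactness of bounded sets of controls. -/
theorem ControlSpace.exists_subseq_tendsto {p : ℝ≥0∞} (hp : 1 < p) {U : Set F}
    (hUc : IsClosed U) (hUconv : Convex ℝ U) (u : ℕ → ControlSpace p U) (D : ℝ≥0)
    (hD : ∀ k, eLpNorm (u k).fn p halfLine ≤ D) :
    ∃ (u₀ : ControlSpace p U) (σ : ℕ → ℕ), StrictMono σ ∧ Tendsto (u ∘ σ) atTop (𝓝 u₀) := by
  have := FiniteDimensional.complete ℝ F
  have hθ := one_sub_one_div_toReal_pos hp
  have hmem : ∀ k, MemLp (u k).fn p halfLine := fun k => Lp.memLp (u k).1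
  have hsm : ∀ k, StronglyMeasurable (u k).fn := fun k => Lp.stronglyMeasurable (u k).1
  have hhol := fun k => holderVariationOn_primitive hp (hmem k).1 (hD k)
  have hVfn : ∀ k t, 0 ≤ t → (StateSpace.ofHolder (primitive (u k).fn) (fun _ => D) _ hθ
      (hhol k)).fn t = primitive (u k).fn t := fun k t ht =>
    StateSpace.ofHolder_fn hθ (hhol k) ht
  obtain ⟨V, σ, hσ, hV⟩ := StateSpace.exists_subseq_tendsto hp
    (fun k => StateSpace.ofHolder (primitive (u k).fn) (fun _ => D) _ hθ (hhol k))
    (fun k r => ‖(u k).fn r‖) 0 (fun _ => D) (fun L k => (hsm k).norm.aestronglyMeasurable)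
    (fun L k => by
      rw [eLpNorm_norm, ← halfLine_restrict_Ioc le_rfl]
      exact (eLpNorm_restrict_le _ _ _ _).trans (hD k))
    (fun k => by rw [hVfn k 0 le_rfl]; simp [primitive])
    (fun k s t hs hst => by
      rw [hVfn k s hs, hVfn k t (hs.trans hst),
        primitive_sub_primitive hp.le (hmem k) hs hst]
      simpa using enorm_integral_le_lintegral_enorm (μ := volume.restrict (Ioc s t)) (u k).fn)
  have hlim : ∀ t, 0 ≤ t → Tendsto (fun k => primitive (u (σ k)).fn t) atTop (𝓝 (V.fn t)) := by
    intro t ht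
    exact (StateSpace.tendsto_fn hV t).congr fun k => hVfn (σ k) t ht
  have hV0 : V.fn 0 = 0 := by
    refine tendsto_nhds_unique (hlim 0 le_rfl) ?_
    simp [primitive]
  have hquot : ∀ h t, 0 < h → 0 ≤ t → Tendsto (fun k => diffQuot h (primitive (u (σ k)).fn) t) atTop
      (𝓝 (diffQuot h V.fn t)) := fun h t hh ht =>
    ((hlim _ (by linarith)).sub (hlim t ht)).const_smul h⁻¹
  have hhpos : ∀ n : ℕ, (0 : ℝ) < 1 / ((n : ℝ) + 1) := fun n => by positivity
  have hpos : ∀ᵐ t ∂halfLine, (0 : ℝ) ≤ t :=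
    (ae_restrict_mem measurableSet_Ioi).mono fun t ht => (mem_Ioi.1 ht).le
  -- Averages of the controls stay in `K`; let `k → ∞` at fixed step, then let the step tend to
  -- zero. This serves both for `U` and, when `p = ∞`, for the ball of radius `D`.
  have hderiv_mem : ∀ K : Set F, IsClosed K → Convex ℝ K →
      (∀ k, ∀ᵐ t ∂halfLine, (u k).fn t ∈ K) → ∀ᵐ t ∂halfLine, deriv V.fn t ∈ K := by
    intro K hKc hKconv hK
    filter_upwards [V.ae_differentiableAt, hpos] with t ht ht0
    refine hKc.mem_of_tendsto (tendsto_diffQuot ht) (Eventually.of_forall fun n => ?_)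
    exact hKc.mem_of_tendsto (hquot _ t (hhpos n) ht0) (Eventually.of_forall fun k =>
      diffQuot_primitive_mem hp.le (hmem _) hKc hKconv (hK _) (hhpos n) ht0)
  have hvm : StronglyMeasurable (deriv V.fn) := stronglyMeasurable_deriv _
  have hvD : eLpNorm (deriv V.fn) p halfLine ≤ D := by
    by_cases hptop : p = ∞
    · subst hptop
      have h := hderiv_mem (Metric.closedBall 0 D) Metric.isClosed_closedBall
        (convex_closedBall _ _) fun k => by
          filter_upwards [ae_le_eLpNormEssSup (f := (u k).fn) (μ := halfLine)] with t ht
          have h1 := ht.trans ((eLpNorm_exponent_top (f := (u k).fn)).symm.le.trans (hD k))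
          rw [mem_closedBall_zero_iff]
          exact_mod_cast h1
      rw [eLpNorm_exponent_top]
      refine essSup_le_of_ae_le _ (h.mono fun t ht => ?_)
      rw [mem_closedBall_zero_iff] at ht
      exact ENNReal.coe_le_coe.2 ht
    · have hm1 : ∀ (f : StateSpace F) (h : ℝ),
          AEStronglyMeasurable (diffQuot h f.fn) halfLine := by
        intro f h
        have hc : Continuous f.fn := f.1.continuous.comp continuous_real_toNNReal
        have : Continuous (diffQuot h f.fn) := by
          unfold diffQuot
          fun_prop
        exact this.aestronglyMeasurable
      -- Fatou is used twice: here as the step tends to zero, and below as `k → ∞` at fixed step.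
      refine eLpNorm_le_of_ae_tendsto (fun n => hm1 V (1 / ((n : ℝ) + 1))) (fun n => ?_)
        (V.ae_differentiableAt.mono fun t ht => tendsto_diffQuot ht)
      refine eLpNorm_le_of_ae_tendsto
        (f := fun k => diffQuot (1 / ((n : ℝ) + 1)) (primitive (u (σ k)).fn)) (fun k => ?_)
        (fun k => (eLpNorm_diffQuot_primitive_le hp hptop (hsm _) (hmem _) (hhpos n)).trans (hD _))
        (hpos.mono fun t ht => hquot _ t (hhpos n) ht)
      refine (hm1 (StateSpace.ofHolder (primitive (u (σ k)).fn) (fun _ => D) _ hθ (hhol (σ k)))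
        (1 / ((n : ℝ) + 1))).congr (hpos.mono fun t ht => ?_)
      simp only [diffQuot]
      rw [hVfn _ _ ht, hVfn _ _ (by have := hhpos n; linarith)]
  have hvmem : MemLp (deriv V.fn) p halfLine :=
    ⟨hvm.aestronglyMeasurable, hvD.trans_lt ENNReal.coe_lt_top⟩
  have hae := hvmem.coeFn_toLp
  refine ⟨⟨hvmem.toLp _, ?_⟩, σ, hσ, ?_⟩
  · filter_upwards [hae, hderiv_mem U hUc hUconv fun k => (u k).2] with t h1 h2
    rwa [h1]
  have hTset : ∀ A, MeasurableSet A → halfLine A < ∞ →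
      Tendsto (fun k => ∫ t in A, (u (σ k)).fn t ∂halfLine) atTop
        (𝓝 (∫ t in A, (hvmem.toLp _ : Lp F p halfLine) t ∂halfLine)) := by
    intro A hAm hA
    rw [integral_congr_ae (ae_restrict_of_ae hae)]
    refine tendsto_setIntegral_of_tendsto_setIntegral_Iic hp (fun k => (hmem _).1)
      (fun k => hD _) hvmem.1 hvD halfLine_Iic_lt_top (fun m => ?_) hAm hA
    simp only [halfLine_restrict_Iic]
    rcases le_or_gt 0 m with hm | hm
    · rw [V.setIntegral_deriv hm (hvmem.integrableOn_Ioc_of_halfLine hp.le le_rfl m), hV0,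
        sub_zero]
      exact hlim m hm
    · simp [Ioc_eq_empty_of_le hm.le]
  refine ControlSpace.tendsto_of_tendsto_integral fun φ => ?_
  have hconj : p.conjExponent.HolderConjugate p := (ENNReal.HolderConjugate.conjExponent hp.le).symm
  refine tendsto_integral_apply_of_tendsto_setIntegral hp.le hconj.one_le ?_ hconj
    (u := fun k => (u (σ k)).1) (D := D) (fun k => ?_) hTset φ
  · simp [ENNReal.conjExponent, tsub_eq_zero_iff_le, hp]
  · rw [Lp.norm_def]
    exact (ENNReal.toReal_mono ENNReal.coe_ne_top (hD (σ k))).trans_eq (ENNReal.coe_toReal D)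

end WeakStar

/-! ### Extended-real integrals with an integrable lower bound -/

section Integrals

theorem eIntegral_le_lintegral (μ : Measure ℝ) (f : ℝ → EReal) :
    eIntegral μ f ≤ ((∫⁻ t, (f t).toENNReal ∂μ : ℝ≥0∞) : EReal) := by
  rw [eIntegral]
  refine EReal.sub_le_of_le_add ?_
  exact le_add_of_nonneg_right (EReal.coe_ennreal_nonneg _)

variable {μ : Measure ℝ} {f : ℝ → EReal} {γ : ℝ → ℝ}

theorem lintegral_neg_toENNReal_le (hf : ∀ᵐ t ∂μ, ((-γ t : ℝ) : EReal) ≤ f t) :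
    ∫⁻ t, (-f t).toENNReal ∂μ ≤ ∫⁻ t, ‖γ t‖ₑ ∂μ := by
  refine lintegral_mono_ae (hf.mono fun t ht => ?_)
  have h1 : -f t ≤ ((γ t : ℝ) : EReal) := by
    rw [EReal.neg_le]
    exact_mod_cast ht
  refine (EReal.toENNReal_le_toENNReal h1).trans ?_
  rw [EReal.real_coe_toENNReal]
  exact Real.ofReal_le_enorm _

theorem eIntegral_ne_bot (hγ : ∫⁻ t, ‖γ t‖ₑ ∂μ ≠ ∞)
    (hf : ∀ᵐ t ∂μ, ((-γ t : ℝ) : EReal) ≤ f t) : eIntegral μ f ≠ ⊥ := by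
  have hN : ∫⁻ t, (-f t).toENNReal ∂μ ≠ ∞ := ne_top_of_le_ne_top hγ (lintegral_neg_toENNReal_le hf)
  rw [eIntegral, sub_eq_add_neg, Ne, EReal.add_eq_bot_iff]
  simp [hN]

theorem lintegral_toENNReal_le_of_eIntegral_le (hγ : ∫⁻ t, ‖γ t‖ₑ ∂μ ≠ ∞)
    (hf : ∀ᵐ t ∂μ, ((-γ t : ℝ) : EReal) ≤ f t) {C : ℝ} (hC : eIntegral μ f ≤ C) :
    ∫⁻ t, (f t).toENNReal ∂μ ≤ ENNReal.ofReal C + ∫⁻ t, ‖γ t‖ₑ ∂μ := by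
  have hNle := lintegral_neg_toENNReal_le hf
  have hN := ne_top_of_le_ne_top hγ hNle
  rw [eIntegral, EReal.sub_le_iff_le_add (by simp) (by simp [hN])] at hC
  rw [← EReal.coe_ennreal_le_coe_ennreal_iff, EReal.coe_ennreal_add, EReal.coe_ennreal_ofReal]
  refine hC.trans (add_le_add ?_ (EReal.coe_ennreal_le_coe_ennreal_iff.2 hNle))
  exact_mod_cast le_max_left C 0

end Integrals

/-- This relation between the exponents places the product of an `L^r_loc` bound on `b` and an `L^p`
control in `L^q_loc`. -/
theorem holderTriple_strongExponent {p q : ℝ≥0∞} (hq : 1 < q) (hqp : q < p) :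
    ENNReal.HolderTriple (strongExponent p q) p q := by
  by_cases hp : p = ∞
  · subst hp
    simp only [strongExponent, if_true]
    infer_instance
  · have hq0 : q ≠ 0 := (zero_lt_one.trans hq).ne'
    have hp0 : p ≠ 0 := (zero_le.trans_lt hqp).ne'
    have hqt : q ≠ ∞ := hqp.ne_top
    refine ⟨?_⟩
    rw [strongExponent, if_neg hp, ENNReal.inv_div (Or.inr (by finiteness)) (Or.inr (by simp [*]))]
    have h1 : p⁻¹ = q / (p * q) := by
      rw [mul_comm, ENNReal.div_eq_inv_mul, ENNReal.mul_inv (by simp [*]) (by simp [*]), mul_right_comm,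
        ENNReal.inv_mul_cancel hq0 hqt, one_mul]
    rw [h1, ENNReal.div_add_div_same, tsub_add_cancel_of_le hqp.le, ENNReal.div_eq_inv_mul,
        ENNReal.mul_inv (by simp [*]) (by simp [*]), mul_right_comm,
        ENNReal.inv_mul_cancel hp0 hp, one_mul]

/-! ### A priori bounds and extraction of subsequences -/

section Systems

variable {E F : Type*} [NormedAddCommGroup E]

/-- Linear growth on balls: a locally Lipschitz field is bounded on every ball by an `L^r_loc`
function of time. -/
theorem LocLipschitzWith.exists_bound [ProperSpace E] {G : Type*} [NormedAddCommGroup G]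
    {g : ℝ → E → G} {r : ℝ≥0∞} (hg : LocLipschitzWith g r) (R : ℝ≥0) :
    ∃ m : ℝ → ℝ, MemLpLoc m r ∧ (∀ t, 0 ≤ m t) ∧
      ∀ᵐ t ∂halfLine, ∀ x, ‖x‖ ≤ R → ‖g t x‖ ≤ m t := by
  obtain ⟨⟨M, hM, hM0⟩, hlip⟩ := hg
  obtain ⟨A, hA, hAH⟩ := hlip _ (isCompact_closedBall (0 : E) R)
  refine ⟨fun t => ‖M t‖ + ‖A t‖ * R, fun L hL => (hM L hL).norm.add ((hA L hL).norm.mul_const R),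
    fun t => by positivity, ?_⟩
  filter_upwards [hM0, hAH] with t h1 h2 x hx
  have h3 := h2 x (by simpa using hx) 0 (by simp)
  have h4 : ‖g t x‖ ≤ ‖g t 0‖ + ‖g t x - g t 0‖ := by
    have := norm_add_le (g t 0) (g t x - g t 0)
    rwa [add_sub_cancel] at this
  rw [sub_zero] at h3
  have h5 : A t * ‖x‖ ≤ ‖A t‖ * R :=
    mul_le_mul (Real.le_norm_self _) hx (norm_nonneg _) (norm_nonneg _)
  have h6 := Real.le_norm_self (M t)
  linarith

variable [NormedSpace ℝ E] [NormedAddCommGroup F] [NormedSpace ℝ F]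
  {p : ℝ≥0∞} {U : Set F} {a : ℝ → E → E} {b : ℝ → E → F →L[ℝ] E}
  {ℓ : ℝ → E → F → EReal} {x₀ : E} {uStar : F} {R : ℝ} {z : ControlSpace p U × StateSpace E}
  {γ : ℝ → ℝ}

theorem ae_le_restrict_Ioc {f : ℝ → EReal} (hf : ∀ᵐ t ∂halfLine, ((-γ t : ℝ) : EReal) ≤ f t)
    (R : ℝ) : ∀ᵐ t ∂volume.restrict (Ioc 0 R), ((-γ t : ℝ) : EReal) ≤ f t := by
  rw [← halfLine_restrict_Ioc le_rfl]
  exact ae_restrict_of_ae hf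

theorem lintegral_enorm_restrict_Ioc_le (γ : ℝ → ℝ) (R : ℝ) :
    ∫⁻ t in Ioc 0 R, ‖γ t‖ₑ ≤ ∫⁻ t, ‖γ t‖ₑ ∂halfLine := by
  rw [← halfLine_restrict_Ioc le_rfl]
  exact setLIntegral_le_lintegral _ _

/-- A pair with finite joint functional is admissible and the positive part of its running cost
has bounded integral. -/
theorem mem_admissibleSet_of_jointFunctional_le (hγ : Integrable γ halfLine)
    (hℓ : ∀ᵐ t ∂halfLine, ∀ (x : E) (u : F), ((-γ t : ℝ) : EReal) ≤ ℓ t x u) {C : ℝ}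
    (hz : jointFunctional a b ℓ x₀ uStar R z ≤ C) :
    z ∈ admissibleSet a b x₀ uStar R ∧
      ∫⁻ t in Ioc 0 R, (ℓ t (z.2.fn t) (z.1.fn t)).toENNReal ≤
        ENNReal.ofReal C + ∫⁻ t, ‖γ t‖ₑ ∂halfLine := by
  have hlow := ae_le_restrict_Ioc (f := fun t => ℓ t (z.2.fn t) (z.1.fn t))
    (hℓ.mono fun t ht => ht _ _) R
  have hle := lintegral_enorm_restrict_Ioc_le γ R
  have hfin : ∫⁻ t in Ioc 0 R, ‖γ t‖ₑ ≠ ∞ := ne_top_of_le_ne_top hγ.2.ne hle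
  by_cases hA : z ∈ admissibleSet a b x₀ uStar R
  · refine ⟨hA, ?_⟩
    rw [jointFunctional, chi, if_pos hA, add_zero] at hz
    refine (lintegral_toENNReal_le_of_eIntegral_le hfin hlow hz).trans ?_
    gcongr
  -- Since `⊥ + ⊤ = ⊥` in `EReal`, excluding an inadmissible pair requires that its cost is not `⊥`.
  · rw [jointFunctional, chi, if_neg hA, cost,
      EReal.add_top_of_ne_bot (eIntegral_ne_bot hfin hlow)] at hz
    simp at hz

theorem norm_state_le_of_norm_le_on_horizon (hz : z ∈ admissibleSet a b x₀ uStar R) (hR : 0 ≤ R)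
    {ρ : ℝ} (h : ∀ t, 0 ≤ t → t ≤ R → ‖z.2.fn t‖ ≤ ρ) {t : ℝ} (ht : 0 ≤ t) : ‖z.2.fn t‖ ≤ ρ := by
  rcases le_or_gt t R with htR | htR
  · exact h t ht htR
  · rw [hz.2.2 t htR, norm_smul, Real.norm_of_nonneg (Real.exp_pos _).le]
    have h1 : Real.exp (-(t - R)) ≤ 1 := Real.exp_le_one_iff.2 (by linarith)
    exact (mul_le_of_le_one_left (norm_nonneg _) h1).trans (h R hR le_rfl)

/-- The dissipation inequality bounds the storage function along admissible states. -/
theorem storage_le_of_mem_admissibleSet {S : E → ℝ} (hS : IsStorageFunction p U a b ℓ S)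
    (hz : z ∈ admissibleSet a b x₀ uStar R) {c : ℝ≥0∞} (hc : c ≠ ∞)
    (hcost : ∫⁻ t in Ioc 0 R, (ℓ t (z.2.fn t) (z.1.fn t)).toENNReal ≤ c) {t : ℝ} (ht : 0 ≤ t)
    (htR : t ≤ R) : S (z.2.fn t) ≤ S x₀ + c.toReal := by
  obtain ⟨τ, y, hy, hRτ, hzy⟩ := hz.2.1
  have h1 := hS.2 z.1 x₀ τ y hy t ht ((EReal.coe_le_coe_iff.2 htR).trans_lt hRτ)
  -- Only the positive part of the cost is monotone in the horizon, hence the passage to it.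
  have h2 : ∫⁻ s in Ioc 0 t, (ℓ s (y s) (z.1.fn s)).toENNReal ≤ c := by
    refine le_trans ?_ hcost
    refine le_trans (le_of_eq ?_) (lintegral_mono_set (Ioc_subset_Ioc_right htR))
    refine setLIntegral_congr_fun measurableSet_Ioc fun s hs => ?_
    simp only [hzy s hs.1.le (hs.2.trans htR)]
  have h3 := h1.trans ((eIntegral_le_lintegral _ _).trans
    (EReal.coe_ennreal_le_coe_ennreal_iff.2 h2))
  rw [← EReal.coe_toReal (x := (c : EReal)) (by simp [hc]) (by simp), EReal.coe_le_coe_iff,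
    EReal.toReal_coe_ennreal] at h3
  rw [hzy t ht htR]
  linarith

theorem lintegral_rpow_control_le (hp : 0 < p.toReal) {α : ℝ} (hα : 0 < α)
    (hγ : Integrable γ halfLine)
    (hℓ : ∀ᵐ t ∂halfLine, ∀ (x : E) (u : F),
      ((α * ‖u‖ ^ p.toReal - γ t : ℝ) : EReal) ≤ ℓ t x u)
    (hz : z ∈ admissibleSet a b x₀ uStar R) (hu : uStar = 0) {c : ℝ≥0∞}
    (hcost : ∫⁻ t in Ioc 0 R, (ℓ t (z.2.fn t) (z.1.fn t)).toENNReal ≤ c) :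
    ∫⁻ t, ‖z.1.fn t‖ₑ ^ p.toReal ∂halfLine ≤
      (ENNReal.ofReal α)⁻¹ * (c + ∫⁻ t, ‖γ t‖ₑ ∂halfLine) := by
  have hα0 : ENNReal.ofReal α ≠ 0 := by simpa using hα
  have h1 : ∫⁻ t, ‖z.1.fn t‖ₑ ^ p.toReal ∂halfLine =
      ∫⁻ t in Ioc 0 R, ‖z.1.fn t‖ₑ ^ p.toReal := by
    rw [← halfLine_restrict_Ioc le_rfl, ← lintegral_indicator measurableSet_Ioc]
    refine lintegral_congr_ae ?_
    filter_upwards [hz.1, ae_restrict_mem measurableSet_Ioi] with t ht ht0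
    by_cases htR : t ≤ R
    · rw [indicator_of_mem (show t ∈ Ioc 0 R from ⟨mem_Ioi.1 ht0, htR⟩)]
    · rw [indicator_of_notMem fun h => htR h.2, ht (not_le.1 htR), hu, enorm_zero,
        ENNReal.zero_rpow_of_pos hp]
  rw [h1, ← ENNReal.mul_le_iff_le_inv hα0 ENNReal.ofReal_ne_top,
    ← lintegral_const_mul' _ _ ENNReal.ofReal_ne_top]
  have hγm : AEMeasurable (fun t => ‖γ t‖ₑ) (volume.restrict (Ioc 0 R)) := by
    rw [← halfLine_restrict_Ioc le_rfl]
    exact hγ.1.enorm.restrict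
  calc ∫⁻ t in Ioc 0 R, ENNReal.ofReal α * ‖z.1.fn t‖ₑ ^ p.toReal
      ≤ ∫⁻ t in Ioc 0 R, ((ℓ t (z.2.fn t) (z.1.fn t)).toENNReal + ‖γ t‖ₑ) := by
        refine lintegral_mono_ae ?_
        rw [← halfLine_restrict_Ioc le_rfl]
        filter_upwards [ae_restrict_of_ae hℓ] with t ht
        have h2 := EReal.toENNReal_le_toENNReal (ht (z.2.fn t) (z.1.fn t))
        rw [EReal.real_coe_toENNReal] at h2
        have h3 : ENNReal.ofReal α * ‖z.1.fn t‖ₑ ^ p.toReal =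
            ENNReal.ofReal (α * ‖z.1.fn t‖ ^ p.toReal) := by
          rw [ENNReal.ofReal_mul hα.le, ← ENNReal.ofReal_rpow_of_nonneg (norm_nonneg _) hp.le,
            ofReal_norm]
        rw [h3]
        refine le_trans ?_ (add_le_add h2 (Real.ofReal_le_enorm (γ t)))
        refine le_trans (ENNReal.ofReal_le_ofReal ?_) ENNReal.ofReal_add_le
        linarith
    _ = (∫⁻ t in Ioc 0 R, (ℓ t (z.2.fn t) (z.1.fn t)).toENNReal) + ∫⁻ t in Ioc 0 R, ‖γ t‖ₑ :=
        lintegral_add_right' _ hγm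
    _ ≤ c + ∫⁻ t, ‖γ t‖ₑ ∂halfLine := add_le_add hcost (lintegral_enorm_restrict_Ioc_le γ R)

/-- Increments of a bounded admissible state are controlled by bounds on the fields. -/
theorem enorm_state_sub_le (hz : z ∈ admissibleSet a b x₀ uStar R) {ρ : ℝ≥0}
    (hρ : ∀ t, 0 ≤ t → ‖z.2.fn t‖ ≤ ρ) {m n : ℝ → ℝ} (hm0 : ∀ t, 0 ≤ m t) (hn0 : ∀ t, 0 ≤ n t)
    (hm : ∀ᵐ t ∂halfLine, ∀ x, ‖x‖ ≤ ρ → ‖a t x‖ ≤ m t)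
    (hn : ∀ᵐ t ∂halfLine, ∀ x, ‖x‖ ≤ ρ → ‖b t x‖ ≤ n t) {s t : ℝ} (hs : 0 ≤ s) (hst : s ≤ t) :
    ‖z.2.fn t - z.2.fn s‖ₑ ≤ ∫⁻ r in Ioc s t, ‖m r + n r * ‖z.1.fn r‖ + ρ‖ₑ := by
  obtain ⟨τ, y, hy, hRτ, hzy⟩ := hz.2.1
  have hac : AbsolutelyContinuousOnInterval z.2.fn s t := by
    have h := z.2.2 t.toNNReal
    rw [Real.coe_toNNReal _ (hs.trans hst)] at h
    refine h.mono ?_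
    rw [uIcc_of_le hst, uIcc_of_le (hs.trans hst)]
    exact Icc_subset_Icc_left hs
  refine hac.enorm_sub_le_lintegral hst ?_
  rw [← halfLine_restrict_Ioc hs]
  refine ae_restrict_of_ae ?_
  -- The state may have a corner at `R`. Before `R` the equation bounds the derivative by `m +
  -- n|u|`; after `R` its norm is that of the state, which accounts for the summand `ρ`.
  have hne : ∀ᵐ r ∂halfLine, r ≠ R := ae_restrict_of_ae (Measure.ae_ne volume R)
  filter_upwards [hm, hn, hy.1.2.2.2, hne, ae_restrict_mem measurableSet_Ioi]
    with r hmr hnr hyr hrR hr0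
  have hr0' : 0 < r := hr0
  have hle : ∀ v : E, ‖v‖ ≤ m r + n r * ‖z.1.fn r‖ + ρ →
      ‖v‖ₑ ≤ ‖m r + n r * ‖z.1.fn r‖ + ρ‖ₑ := fun v hv =>
    enorm_le_iff_norm_le.2 (hv.trans (Real.le_norm_self _))
  have hprod : 0 ≤ n r * ‖z.1.fn r‖ := mul_nonneg (hn0 r) (norm_nonneg _)
  rcases lt_or_gt_of_ne hrR with hlt | hgt
  · have heq : z.2.fn =ᶠ[𝓝 r] y := by
      filter_upwards [Ioo_mem_nhds hr0' hlt] with t' ht'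
      exact hzy t' ht'.1.le ht'.2.le
    refine ⟨_, (hyr ((EReal.coe_lt_coe_iff.2 hlt).trans hRτ)).congr_of_eventuallyEq heq,
      hle _ ?_⟩
    have hyρ : ‖y r‖ ≤ ρ := by
      rw [← hzy r hr0'.le hlt.le]
      exact hρ r hr0'.le
    have h1 := norm_add_le (a r (y r)) (b r (y r) (z.1.fn r))
    have h2 := hmr _ hyρ
    have h3 : ‖b r (y r) (z.1.fn r)‖ ≤ n r * ‖z.1.fn r‖ :=
      (b r (y r)).le_of_opNorm_le (hnr _ hyρ) _
    have h4 := ρ.2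
    linarith
  · have heq : z.2.fn =ᶠ[𝓝 r] fun t' => Real.exp (-(t' - R)) • z.2.fn R := by
      filter_upwards [Ioi_mem_nhds hgt] with t' ht'
      exact hz.2.2 t' ht'
    have hd : HasDerivAt (fun t' => Real.exp (-(t' - R))) (Real.exp (-(r - R)) * -1) r :=
      (((hasDerivAt_id r).sub_const R).neg).exp
    refine ⟨_, (hd.smul_const (z.2.fn R)).congr_of_eventuallyEq heq, hle _ ?_⟩
    have h1 : ‖(Real.exp (-(r - R)) * -1) • z.2.fn R‖ = ‖z.2.fn r‖ := by
      rw [hz.2.2 r hgt, mul_neg_one, neg_smul, norm_neg]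
    rw [h1]
    have h2 := hρ r hr0'.le
    have h3 := hm0 r
    linarith

/-- Admissible pairs with uniformly bounded states and controls have convergent subsequences. -/
theorem exists_subseq_tendsto_of_bounded [FiniteDimensional ℝ E] [FiniteDimensional ℝ F]
    {q : ℝ≥0∞} (hq : 1 < q) (hqp : q < p) (hUc : IsClosed U) (hUconv : Convex ℝ U)
    (hab : CaratheodoryLipschitz a b q (strongExponent p q)) {T : ℕ → ℝ}
    {z : ℕ → ControlSpace p U × StateSpace E} (hz : ∀ k, z k ∈ admissibleSet a b x₀ uStar (T k))
    {ρ D : ℝ≥0} (hρ : ∀ k t, 0 ≤ t → ‖(z k).2.fn t‖ ≤ ρ)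
    (hD : ∀ k, eLpNorm (z k).1.fn p halfLine ≤ D) :
    ∃ (z₀ : ControlSpace p U × StateSpace E) (σ : ℕ → ℕ), StrictMono σ ∧
      Tendsto (z ∘ σ) atTop (𝓝 z₀) := by
  have : ProperSpace E := FiniteDimensional.proper ℝ E
  have hHolder := holderTriple_strongExponent hq hqp
  obtain ⟨u₀, σ₁, hσ₁, hu⟩ := ControlSpace.exists_subseq_tendsto (hq.trans hqp) hUc hUconv
    (fun k => (z k).1) D hD
  obtain ⟨m, hm, hm0, hma⟩ := hab.1.exists_bound ρ
  obtain ⟨n, hn, hn0, hnb⟩ := hab.2.exists_bound ρ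
  -- `MemLpLoc` speaks of positive horizons only; `L + 1` covers `L = 0`.
  have hmL : ∀ L : ℝ≥0, MemLp m q (volume.restrict (Ioc 0 (L : ℝ))) := fun L =>
    (hm (L + 1) (by positivity)).mono_measure
      (Measure.restrict_mono_set _ (Ioc_subset_Ioc_right (by linarith)))
  have hnL : ∀ L : ℝ≥0, MemLp n (strongExponent p q) (volume.restrict (Ioc 0 (L : ℝ))) := fun L =>
    (hn (L + 1) (by positivity)).mono_measure
      (Measure.restrict_mono_set _ (Ioc_subset_Ioc_right (by linarith)))
  have hcL : ∀ L : ℝ≥0, MemLp (fun _ : ℝ => (ρ : ℝ)) q (volume.restrict (Ioc 0 (L : ℝ))) :=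
    fun L => memLp_const _
  have hum : ∀ (L : ℝ≥0) k, AEStronglyMeasurable (fun r => ‖(z k).1.fn r‖)
      (volume.restrict (Ioc 0 (L : ℝ))) := fun L k =>
    (Lp.stronglyMeasurable (z k).1.1).norm.aestronglyMeasurable
  have huL : ∀ (L : ℝ≥0) k, eLpNorm (fun r => ‖(z k).1.fn r‖) p (volume.restrict (Ioc 0 (L : ℝ)))
      ≤ D := by
    intro L k
    rw [eLpNorm_norm, ← halfLine_restrict_Ioc le_rfl]
    exact (eLpNorm_restrict_le _ _ _ _).trans (hD k)
  set Δ : ℝ≥0 → ℝ≥0∞ := fun L => eLpNorm m q (volume.restrict (Ioc 0 (L : ℝ))) +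
    eLpNorm n (strongExponent p q) (volume.restrict (Ioc 0 (L : ℝ))) * D +
    eLpNorm (fun _ : ℝ => (ρ : ℝ)) q (volume.restrict (Ioc 0 (L : ℝ)))
  have hΔ : ∀ L, Δ L ≠ ∞ := fun L => ENNReal.add_ne_top.2 ⟨ENNReal.add_ne_top.2
    ⟨(hmL L).2.ne, ENNReal.mul_ne_top (hnL L).2.ne ENNReal.coe_ne_top⟩, (hcL L).2.ne⟩
  obtain ⟨y₀, σ₂, hσ₂, hy⟩ := StateSpace.exists_subseq_tendsto hq (fun k => (z (σ₁ k)).2)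
    (fun k r => m r + n r * ‖(z (σ₁ k)).1.fn r‖ + ρ) ρ (fun L => (Δ L).toNNReal)
    (fun L k => ((hmL L).1.add ((hnL L).1.mul (hum L _))).add (hcL L).1)
    (fun L k => by
      rw [ENNReal.coe_toNNReal (hΔ L)]
      refine (eLpNorm_add_le ((hmL L).1.add ((hnL L).1.mul (hum L _))) (hcL L).1 hq.le).trans ?_
      refine add_le_add_left ((eLpNorm_add_le (hmL L).1 ((hnL L).1.mul (hum L _)) hq.le).trans ?_) _
      refine add_le_add_right ?_ _
      have h := eLpNorm_smul_le_mul_eLpNorm (p := strongExponent p q) (q := p) (r := q)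
        (hum L (σ₁ k)) (hnL L).1
      exact h.trans (mul_le_mul_right (huL L _) _))
    (fun k => hρ _ 0 le_rfl)
    (fun k s t hs hst => enorm_state_sub_le (hz _) (hρ _) hm0 hn0 hma hnb hs hst)
  exact ⟨(u₀, y₀), σ₁ ∘ σ₂, hσ₁.comp hσ₂, (hu.comp hσ₂.tendsto_atTop).prodMk_nhds hy⟩

/-- Uniform bounds on the states and controls of pairs with bounded joint functionals. -/
theorem exists_bounds_of_jointFunctional_le (hp : 1 < p) (hu : p ≠ ∞ → uStar = 0)
    (h_diss : ∃ S : E → ℝ, IsStorageFunction p U a b ℓ S ∧ CoerciveFun S)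
    (h_fin : p ≠ ∞ → ∃ (α : ℝ) (γ : ℝ → ℝ), 0 < α ∧ Integrable γ halfLine ∧
      ∀ᵐ t ∂halfLine, ∀ (x : E) (u : F),
        ((α * ‖u‖ ^ p.toReal - γ t : ℝ) : EReal) ≤ ℓ t x u)
    (h_inf : p = ∞ → IsCompact U ∧ ∃ γ : ℝ → ℝ, Integrable γ halfLine ∧
      ∀ᵐ t ∂halfLine, ∀ (x : E) (u : F), ((-γ t : ℝ) : EReal) ≤ ℓ t x u)
    {T : ℕ → ℝ} (hT : ∀ k, 0 ≤ T k) {C : ℝ} {z : ℕ → ControlSpace p U × StateSpace E}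
    (hz : ∀ k, jointFunctional a b ℓ x₀ uStar (T k) (z k) ≤ C) :
    ∃ ρ D : ℝ≥0, ∀ k, z k ∈ admissibleSet a b x₀ uStar (T k) ∧
      (∀ t, 0 ≤ t → ‖(z k).2.fn t‖ ≤ ρ) ∧ eLpNorm (z k).1.fn p halfLine ≤ D := by
  obtain ⟨S, hS, hcoer⟩ := h_diss
  have hstate : ∀ γ : ℝ → ℝ, Integrable γ halfLine →
      (∀ᵐ t ∂halfLine, ∀ (x : E) (u : F), ((-γ t : ℝ) : EReal) ≤ ℓ t x u) →
      ∃ ρ : ℝ≥0, ∀ k t, 0 ≤ t → ‖(z k).2.fn t‖ ≤ ρ := by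
    intro γ hγ hℓ
    set c : ℝ≥0∞ := ENNReal.ofReal C + ∫⁻ t, ‖γ t‖ₑ ∂halfLine
    have hc : c ≠ ∞ := ENNReal.add_ne_top.2 ⟨ENNReal.ofReal_ne_top, hγ.2.ne⟩
    obtain ⟨ρ, hρ⟩ := (hcoer (S x₀ + c.toReal)).exists_norm_le
    refine ⟨ρ.toNNReal, fun k t ht => ?_⟩
    obtain ⟨hA, hcost⟩ := mem_admissibleSet_of_jointFunctional_le hγ hℓ (hz k)
    refine (norm_state_le_of_norm_le_on_horizon hA (hT k) (fun t ht htT => ?_) ht).trans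
      (Real.le_coe_toNNReal ρ)
    exact hρ _ (storage_le_of_mem_admissibleSet hS hA hc hcost ht htT)
  by_cases hptop : p = ∞
  · obtain ⟨hUcomp, γ, hγ, hℓ⟩ := h_inf hptop
    obtain ⟨ρ, hρ⟩ := hstate γ hγ hℓ
    obtain ⟨B, hB⟩ := hUcomp.isBounded.exists_norm_le
    refine ⟨ρ, B.toNNReal, fun k => ⟨(mem_admissibleSet_of_jointFunctional_le hγ hℓ (hz k)).1,
      hρ k, ?_⟩⟩
    subst hptop
    rw [eLpNorm_exponent_top]
    exact eLpNormEssSup_le_of_ae_bound ((z k).1.2.mono fun t ht => hB _ ht)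
  · obtain ⟨α, γ, hα, hγ, hℓ⟩ := h_fin hptop
    have hp0 : p ≠ 0 := (zero_lt_one.trans hp).ne'
    have hP : 0 < p.toReal := ENNReal.toReal_pos hp0 hptop
    have hℓ' : ∀ᵐ t ∂halfLine, ∀ (x : E) (u : F), ((-γ t : ℝ) : EReal) ≤ ℓ t x u := by
      filter_upwards [hℓ] with t ht x u
      refine le_trans (EReal.coe_le_coe_iff.2 ?_) (ht x u)
      have : 0 ≤ α * ‖u‖ ^ p.toReal := by positivity
      linarith
    obtain ⟨ρ, hρ⟩ := hstate γ hγ hℓ'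
    -- One `∫|γ|` comes from bounding the positive part of the cost, the other from `α|u|^p ≤ ℓ +
    -- γ`.
    set d : ℝ≥0∞ := ((ENNReal.ofReal α)⁻¹ * (ENNReal.ofReal C + ∫⁻ t, ‖γ t‖ₑ ∂halfLine +
      ∫⁻ t, ‖γ t‖ₑ ∂halfLine)) ^ (1 / p.toReal)
    have hd : d ≠ ∞ := by
      refine ENNReal.rpow_ne_top_of_nonneg (by positivity) (ENNReal.mul_ne_top ?_ ?_)
      · simpa using hα
      · exact ENNReal.add_ne_top.2
          ⟨ENNReal.add_ne_top.2 ⟨ENNReal.ofReal_ne_top, hγ.2.ne⟩, hγ.2.ne⟩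
    refine ⟨ρ, d.toNNReal, fun k => ?_⟩
    obtain ⟨hA, hcost⟩ := mem_admissibleSet_of_jointFunctional_le hγ hℓ' (hz k)
    refine ⟨hA, hρ k, ?_⟩
    rw [ENNReal.coe_toNNReal hd, eLpNorm_eq_lintegral_rpow_enorm_toReal hp0 hptop]
    exact ENNReal.rpow_le_rpow (lintegral_rpow_control_le hP hα hγ hℓ hA (hu hptop) hcost)
      (by positivity)

end Systems

end OptControl

theorem mainTheorem2
    {E F : Type*}
    [NormedAddCommGroup E] [NormedSpace ℝ E] [FiniteDimensional ℝ E]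
    [MeasurableSpace E] [BorelSpace E]
    [NormedAddCommGroup F] [NormedSpace ℝ F] [FiniteDimensional ℝ F]
    [MeasurableSpace F] [BorelSpace F]
    (p q : ℝ≥0∞) (hq : 1 < q) (hqp : q < p)
    (U : Set F) (hU_nonempty : U.Nonempty) (hU_closed : IsClosed U) (hU_convex : Convex ℝ U)
    (hU : p ≠ ∞ → U = Set.univ)
    (uStar : F) (h_uStar_mem : uStar ∈ U) (h_uStar : p ≠ ∞ → uStar = 0)
    (a : ℝ → E → E) (b : ℝ → E → F →L[ℝ] E)
    (hab : OptControl.CaratheodoryLipschitz a b q (OptControl.strongExponent p q))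
    (ℓ : ℝ → E → F → EReal) (hℓ : OptControl.IsIntegrand ℓ)
    (h_diss : ∃ S : E → ℝ, OptControl.IsStorageFunction p U a b ℓ S ∧ OptControl.CoerciveFun S)
    (h_fin : p ≠ ∞ → ∃ (α : ℝ) (γ : ℝ → ℝ), 0 < α ∧ Integrable γ OptControl.halfLine ∧
      ∀ᵐ t ∂OptControl.halfLine, ∀ (x : E) (u : F),
        ((α * ‖u‖ ^ p.toReal - γ t : ℝ) : EReal) ≤ ℓ t x u)
    (h_inf : p = ∞ → IsCompact U ∧ ∃ γ : ℝ → ℝ, Integrable γ OptControl.halfLine ∧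
      ∀ᵐ t ∂OptControl.halfLine, ∀ (x : E) (u : F), ((-γ t : ℝ) : EReal) ≤ ℓ t x u)
    (x₀ : E) (T : ℕ → ℝ) (hT_nonneg : ∀ k, 0 ≤ T k) (hT : Tendsto T atTop atTop) :
    (∀ C : ℝ, 0 < C →
      ∀ z : ℕ → OptControl.ControlSpace p U × OptControl.StateSpace E,
        (∀ k, OptControl.jointFunctional a b ℓ x₀ uStar (T k) (z k) ≤ (C : EReal)) →
        ∃ R : ℝ≥0, ∀ k, eLpNorm (z k).2.fn ∞ OptControl.halfLine ≤ R) ∧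
    OptControl.SeqEquiCoercive
      (fun k (z : OptControl.ControlSpace p U × OptControl.StateSpace E) =>
        OptControl.jointFunctional a b ℓ x₀ uStar (T k) z) := by
  have hbdd := fun (C : ℝ) (z : ℕ → OptControl.ControlSpace p U × OptControl.StateSpace E)
    (hz : ∀ k, OptControl.jointFunctional a b ℓ x₀ uStar (T k) (z k) ≤ (C : EReal)) =>
    OptControl.exists_bounds_of_jointFunctional_le (hq.trans hqp) h_uStar h_diss h_fin h_inf
      hT_nonneg hz
  constructor
  · intro C _ z hz
    obtain ⟨ρ, D, h⟩ := hbdd C z hz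
    refine ⟨ρ, fun k => ?_⟩
    rw [eLpNorm_exponent_top]
    refine eLpNormEssSup_le_of_ae_nnnorm_bound ?_
    filter_upwards [ae_restrict_mem measurableSet_Ioi] with t ht
    exact (h k).2.1 t (mem_Ioi.1 ht).le
  · intro C _ z hz
    obtain ⟨ρ, D, h⟩ := hbdd C z hz
    exact OptControl.exists_subseq_tendsto_of_bounded hq hqp hU_closed hU_convex hab
      (fun k => (h k).1) (fun k => (h k).2.1) fun k => (h k).2.2
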